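/- Let $S \subset \mathbb{R}^2$ be a finite set. A \emph{geometric triangulation} of $S$ is a simplicial complex in $\mathbb{R}^2$ whose vertex set is $S$ and whose underlying space is the convex hull of $S$. A geometric triangulation $D$ of $S$ is a \emph{Delaunay triangulation} if no point of $S$ lies strictly inside the circumcircle of a triangle of $D$. For a triangle $\Delta$ with edge lengths $a, b, c$, let $|\Delta|$ be its area and $R_\Delta$ its circumradius, and put $\mathrm{Rf}(\Delta) = \frac{|\Delta|}{12}(a^2+b^2+c^2)$ and $p(\Delta) = abc$. If $\Delta$ is acute, let $\mathrm{Vf}(\Delta) = \int_{\Delta} \min_{v} \|x - v\|^2 \, dx$, the minimum being over the three vertices $v$ of $\Delta$; otherwise let $\mathrm{Vf}(\Delta) = \frac{|\Delta|}{12}(a^2+b^2+c^2-4R_\Delta^2)$. For a geometric triangulation $K$ of $S$ let $\mathrm{Rf}(K)$ and $\mathrm{Vf}(K)$ be the sums of $\mathrm{Rf}(\Delta)$ and $\mathrm{Vf}(\Delta)$ over all triangles $\Delta$ of $K$, and for real $\alpha$ let $R_\alpha(K) = \sum_{\Delta \in K} R_\Delta^{\alpha}\, |\Delta|$. Then: 1.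 $S$ has a Delaunay triangulation. If no four points of $S$ lie on a common circle, then the triangles of any Delaunay triangulation of $S$ are exactly the (nondegenerate) triangles spanned by three points of $S$ whose circumcircle has no point of $S$ strictly inside. 2. For every Delaunay triangulation $D$ and every geometric triangulation $K$ of $S$, $R_2(D) \le R_2(K)$ and $R_1(D) \le R_1(K)$. 3. For every geometric triangulation $K$ of $S$, $R_2(K) = 3\,\mathrm{Rf}(K) - 3\,\mathrm{Vf}(K)$ and $R_1(K) = \frac14 \sum_{\Delta \in K} p(\Delta)$. -/

import Mathlib

/-- The Euclidean plane. -/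
abbrev Plane : Type := EuclideanSpace ℝ (Fin 2)

/-! ### Quantities attached to a triangle, given as the finite set of its three vertices -/

/-- The area of the triangle with vertex set `t`: the Lebesgue measure of its convex hull. -/
noncomputable def triangleArea (t : Finset Plane) : ℝ :=
  (MeasureTheory.volume (convexHull ℝ (t : Set Plane))).toReal

/-- The radius of a circle through all points of `t`. For the three vertices of a triangle there
is exactly one such circle, and the set below has exactly one element. -/
noncomputable def triangleCircumradius (t : Finset Plane) : ℝ :=
  sInf {r : ℝ | ∃ c : Plane, ∀ p ∈ t, dist p c = r}

/-- For a nondegenerate triangle, `triangleCircumradius` is Mathlib's circumradius. -/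
theorem triangleCircumradius_eq (T : Affine.Triangle ℝ Plane) (t : Finset Plane)
    (h : (t : Set Plane) = Set.range T.points) : triangleCircumradius t = T.circumradius := by
  have hspan : affineSpan ℝ (Set.range T.points) = ⊤ :=
    T.independent.affineSpan_eq_top_iff_card_eq_finrank_add_one.2 (by simp)
  have hmem : ∀ p : Plane, p ∈ t ↔ ∃ i, T.points i = p := fun p => by
    rw [← Finset.mem_coe, h, Set.mem_range]
  have hset : {r : ℝ | ∃ c : Plane, ∀ p ∈ t, dist p c = r} = {T.circumradius} := by
    ext r
    simp only [Set.mem_ofPred_eq, Set.mem_singleton_iff]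
    constructor
    · rintro ⟨c, hc⟩
      exact T.eq_circumradius_of_dist_eq (by rw [hspan]; trivial)
        (fun i => hc _ ((hmem _).2 ⟨i, rfl⟩))
    · rintro rfl
      refine ⟨T.circumcenter, fun p hp => ?_⟩
      obtain ⟨i, rfl⟩ := (hmem p).1 hp
      exact T.dist_circumcenter_eq_circumradius i
  rw [triangleCircumradius, hset, csInf_singleton]

/-- The edges of the triangle `t`: its two-element subsets. -/
def triangleEdges (t : Finset Plane) : Finset (Finset Plane) := t.powersetCard 2

/-- The length of the edge `e = {p, q}`: the diameter of `{p, q}`, which is `dist p q`. -/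
noncomputable def edgeLength (e : Finset Plane) : ℝ := Metric.diam (e : Set Plane)

/-- The sum `a² + b² + c²` of the squared edge lengths. -/
noncomputable def sumSqEdges (t : Finset Plane) : ℝ := ∑ e ∈ triangleEdges t, edgeLength e ^ 2

/-- The product `a b c` of the edge lengths. -/
noncomputable def prodEdges (t : Finset Plane) : ℝ := ∏ e ∈ triangleEdges t, edgeLength e

/-- All angles of the triangle `t` are acute. -/
def IsAcute (t : Finset Plane) : Prop :=
  ∀ A ∈ t, ∀ B ∈ t, ∀ C ∈ t, A ≠ B → B ≠ C → C ≠ A →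
    EuclideanGeometry.angle A B C < Real.pi / 2

/-- The Rajan functional of a triangle. -/
noncomputable def rajanTriangle (t : Finset Plane) : ℝ :=
  triangleArea t / 12 * sumSqEdges t

open Classical in
/-- The Voronoi functional of a triangle: for an acute triangle the integral over the triangle of
the squared distance to the nearest vertex, and for a triangle that is not acute the expression
`area / 12 * (a² + b² + c² - 4 R²)`. -/
noncomputable def voronoiTriangle (t : Finset Plane) : ℝ :=
  if IsAcute t then
    ∫ x in convexHull ℝ (t : Set Plane), Metric.infDist x (t : Set Plane) ^ 2
  else
    triangleArea t / 12 * (sumSqEdges t - 4 * triangleCircumradius t ^ 2)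

/-! ### Geometric triangulations -/

/-- A geometric triangulation of `S`: a simplicial complex in the plane with vertex set `S` and
underlying space the convex hull of `S`. -/
structure GeometricTriangulation (S : Finset Plane) extends
    Geometry.SimplicialComplex ℝ Plane where
  vertices_eq : toSimplicialComplex.vertices = (S : Set Plane)
  space_eq : toSimplicialComplex.space = convexHull ℝ (S : Set Plane)

/-- No four points of `S` lie on a common circle. -/
def NoFourCocircular (S : Finset Plane) : Prop :=
  ∀ (c : Plane) (r : ℝ), ∀ t ⊆ S, (∀ p ∈ t, dist p c = r) → t.card ≤ 3

open Classical in
/-- The triangles spanned by three points of `S` whose circumcircle encloses no point of `S`. -/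
noncomputable def delaunayTriangles (S : Finset Plane) : Finset (Finset Plane) :=
  {t ∈ S.powersetCard 3 | AffineIndependent ℝ ((↑) : t → Plane) ∧
    ∃ (c : Plane) (r : ℝ), (∀ p ∈ t, dist p c = r) ∧ ∀ q ∈ S, r ≤ dist q c}

namespace GeometricTriangulation

open Classical in
/-- The triangles (two-dimensional simplices) of a geometric triangulation. -/
noncomputable def triangles {S : Finset Plane} (K : GeometricTriangulation S) :
    Finset (Finset Plane) :=
  {t ∈ S.powersetCard 3 | t ∈ K.faces}

theorem mem_triangles {S : Finset Plane} (K : GeometricTriangulation S) (t : Finset Plane) :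
    t ∈ K.triangles ↔ t ∈ K.faces ∧ t.card = 3 := by
  classical
  simp only [triangles, Finset.mem_filter, Finset.mem_powersetCard]
  constructor
  · rintro ⟨⟨-, h⟩, h'⟩
    exact ⟨h', h⟩
  · rintro ⟨h, h'⟩
    refine ⟨⟨fun p hp => ?_, h'⟩, h⟩
    have hp' : p ∈ K.toSimplicialComplex.vertices :=
      K.down_closed h (Finset.singleton_subset_iff.2 hp) (Finset.singleton_nonempty p)
    rw [K.vertices_eq] at hp'
    exact hp'

/-- `K` is a Delaunay triangulation of `S`: no point of `S` is enclosed by the circumcircle of a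
triangle of `K`. -/
def IsDelaunay {S : Finset Plane} (K : GeometricTriangulation S) : Prop :=
  K.triangles ⊆ delaunayTriangles S

/-- The functional `R_α`: the sum over all triangles of (circumradius)^α times area. -/
noncomputable def radiusFunctional {S : Finset Plane} (α : ℝ) (K : GeometricTriangulation S) : ℝ :=
  ∑ t ∈ K.triangles, triangleCircumradius t ^ α * triangleArea t

/-- The Rajan functional of a geometric triangulation. -/
noncomputable def rajan {S : Finset Plane} (K : GeometricTriangulation S) : ℝ :=
  ∑ t ∈ K.triangles, rajanTriangle t

/-- The Voronoi functional of a geometric triangulation. -/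
noncomputable def voronoi {S : Finset Plane} (K : GeometricTriangulation S) : ℝ :=
  ∑ t ∈ K.triangles, voronoiTriangle t

end GeometricTriangulation

/-!
Existence: heights on `S` that are generic and close to `‖x‖ ^ 2` lift `S` to points in space whose
lower convex hull projects to a Delaunay triangulation; genericity makes all its faces triangles.
If `S` is collinear, the triangulation of `S` together with one point off the line contains one
of `S`.

Minimality: a triangulation that is not Delaunay has a flippable edge `a b`, with triangles `a b c`
and `a b d`, where `d` lies inside the circumcircle of `a b c`. Replacing `a b` by `c d` decreases
`R_1` and `R_2` strictly, so that their minimizers are Delaunay. Two Delaunay triangles with a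
common point in general position have the same circumcircle, hence all Delaunay triangulations have
the same value of `R_α`.

Identities: `R * area = a * b * c / 4` gives the formula for `R_1`. For `R_2` an acute triangle is
cut at its circumcenter and at the midpoints of its edges into six triangles, on each of which the
nearest vertex is constant.
-/

open EuclideanGeometry Filter MeasureTheory Topology

section ConvexHullTriple

variable {𝕜 E : Type*} [Field 𝕜] [LinearOrder 𝕜] [IsStrictOrderedRing 𝕜] [AddCommGroup E]
  [Module 𝕜 E]

theorem mem_convexHull_triple {a b c x : E} :
    x ∈ convexHull 𝕜 ({a, b, c} : Set E) ↔
      ∃ α β γ : 𝕜, 0 ≤ α ∧ 0 ≤ β ∧ 0 ≤ γ ∧ α + β + γ = 1 ∧ α • a + β • b + γ • c = x := by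
  constructor
  · intro h
    rw [convexHull_insert (Set.insert_nonempty _ _), convexJoin_singleton_left,
      Set.mem_iUnion₂, convexHull_pair] at h
    obtain ⟨y, ⟨s, t, hs, ht, hst, rfl⟩, u, v, hu, hv, huv, rfl⟩ := h
    refine ⟨u, v * s, v * t, hu, mul_nonneg hv hs, mul_nonneg hv ht, ?_, by module⟩
    linear_combination huv + v * hst
  · rintro ⟨α, β, γ, hα, hβ, hγ, h1, rfl⟩
    have := (convex_convexHull 𝕜 ({a, b, c} : Set E)).sum_mem (t := Finset.univ)
      (w := ![α, β, γ]) (z := ![a, b, c])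
      (by intro i _; fin_cases i <;> simpa) (by simpa [Fin.sum_univ_three])
      (by intro i _; apply subset_convexHull; fin_cases i <;> simp)
    simpa [Fin.sum_univ_three] using this

end ConvexHullTriple

theorem exists_eq_triple_of_mem {α : Type*} [DecidableEq α] {t : Finset α} {a b : α} (hab : a ≠ b)
    (ha : a ∈ t) (hb : b ∈ t) (ht : t.card = 3) : ∃ c, t = {a, b, c} := by
  have hb' : b ∈ t.erase a := Finset.mem_erase.2 ⟨hab.symm, hb⟩
  obtain ⟨c, hc⟩ : ∃ c, (t.erase a).erase b = {c} := Finset.card_eq_one.1 <| by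
    rw [Finset.card_erase_of_mem hb', Finset.card_erase_of_mem ha, ht]
  exact ⟨c, by rw [← hc, Finset.insert_erase hb', Finset.insert_erase ha]⟩

theorem plane_ext {x y : Plane} (h0 : x 0 = y 0) (h1 : x 1 = y 1) : x = y :=
  PiLp.ext (Fin.forall_fin_two.2 ⟨h0, h1⟩)

theorem dist_sq_plane (p q : Plane) : dist p q ^ 2 = (p 0 - q 0) ^ 2 + (p 1 - q 1) ^ 2 := by
  rw [EuclideanSpace.dist_sq_eq, Fin.sum_univ_two, Real.dist_eq, Real.dist_eq, sq_abs, sq_abs]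

/-- The orientation of the ordered triple `a`, `b`, `c`, as twice the signed area of the triangle
they span: positive if and only if the triple is in counterclockwise order. -/
def orient (a b c : Plane) : ℝ :=
  (b 0 - a 0) * (c 1 - a 1) - (b 1 - a 1) * (c 0 - a 0)

theorem orient_swap (a b c : Plane) : orient b a c = -orient a b c := by
  unfold orient; ring

theorem orient_rotate (a b c : Plane) : orient b c a = orient a b c := by
  unfold orient; ring

theorem orient_self_right (a b : Plane) : orient a b b = 0 := by
  unfold orient; ring

theorem orient_self_mid (a b : Plane) : orient a b a = 0 := by
  unfold orient; ring

theorem ne_of_orient_ne_zero {a b c : Plane} (h : orient a b c ≠ 0) : a ≠ b ∧ a ≠ c ∧ b ≠ c := by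
  refine ⟨?_, ?_, ?_⟩ <;> rintro rfl <;> apply h <;> unfold orient <;> ring

theorem orient_add (a b c x : Plane) :
    orient x b c + orient a x c + orient a b x = orient a b c := by
  unfold orient; ring

theorem orient_lineMap (p q x y : Plane) (τ : ℝ) :
    orient p q (AffineMap.lineMap x y τ) = (1 - τ) * orient p q x + τ * orient p q y := by
  simp only [AffineMap.lineMap_apply_module, orient, PiLp.add_apply, PiLp.smul_apply, smul_eq_mul]
  ring

theorem orient_of_combination {a b c x : Plane} {α β γ : ℝ} (h : α + β + γ = 1)
    (hx : α • a + β • b + γ • c = x) :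
    orient x b c = α * orient a b c ∧ orient a x c = β * orient a b c ∧
      orient a b x = γ * orient a b c := by
  subst hx
  obtain rfl : α = 1 - β - γ := by linarith
  simp only [orient, PiLp.add_apply, PiLp.smul_apply, smul_eq_mul]
  refine ⟨?_, ?_, ?_⟩ <;> ring

theorem orient_combination_eq {a b c : Plane} (x : Plane) (h : orient a b c ≠ 0) :
    (orient x b c / orient a b c) • a + (orient a x c / orient a b c) • b +
      (orient a b x / orient a b c) • c = x := by
  apply plane_ext <;>
  · simp only [PiLp.add_apply, PiLp.smul_apply, smul_eq_mul]
    field_simp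
    unfold orient
    ring

theorem mem_convexHull_triple_iff_orient {a b c x : Plane} (h : 0 < orient a b c) :
    x ∈ convexHull ℝ ({a, b, c} : Set Plane) ↔
      0 ≤ orient x b c ∧ 0 ≤ orient a x c ∧ 0 ≤ orient a b x := by
  rw [mem_convexHull_triple]
  constructor
  · rintro ⟨α, β, γ, hα, hβ, hγ, h1, hx⟩
    obtain ⟨ha, hb, hc⟩ := orient_of_combination h1 hx
    rw [ha, hb, hc]
    exact ⟨by positivity, by positivity, by positivity⟩
  · rintro ⟨h1, h2, h3⟩
    exact ⟨_, _, _, div_nonneg h1 h.le, div_nonneg h2 h.le, div_nonneg h3 h.le,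
      by rw [← add_div, ← add_div, orient_add, div_self h.ne'], orient_combination_eq x h.ne'⟩

theorem exists_orient_eq_mul_of_mem_convexHull {a b c x : Plane}
    (hx : x ∈ convexHull ℝ ({a, b, c} : Set Plane)) :
    ∃ w : ℝ, 0 ≤ w ∧ orient a b x = w * orient a b c := by
  obtain ⟨u, v, w, -, -, hw, hsum, hcomb⟩ := mem_convexHull_triple.1 hx
  exact ⟨w, hw, (orient_of_combination hsum hcomb).2.2⟩

theorem exists_lineMap_eq_of_orient_eq_zero {a b c : Plane} (hab : a ≠ b)
    (h : orient a b c = 0) : ∃ τ : ℝ, AffineMap.lineMap a b τ = c := by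
  have hd : (b 0 - a 0) ^ 2 + (b 1 - a 1) ^ 2 ≠ 0 := by
    rw [← dist_sq_plane]
    exact pow_ne_zero 2 (dist_ne_zero.2 hab.symm)
  refine ⟨((b 0 - a 0) * (c 0 - a 0) + (b 1 - a 1) * (c 1 - a 1)) /
    ((b 0 - a 0) ^ 2 + (b 1 - a 1) ^ 2), ?_⟩
  unfold orient at h
  apply plane_ext <;>
    simp only [AffineMap.lineMap_apply_module, PiLp.add_apply, PiLp.smul_apply, smul_eq_mul] <;>
    field_simp
  · linear_combination (b 1 - a 1) * h
  · linear_combination (a 0 - b 0) * h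

theorem collinear_iff_orient {a b c : Plane} :
    Collinear ℝ ({a, b, c} : Set Plane) ↔ orient a b c = 0 := by
  constructor
  · rw [collinear_iff_of_mem (Set.mem_insert a _)]
    rintro ⟨v, hv⟩
    obtain ⟨r, hr⟩ := hv b (by simp)
    obtain ⟨s, hs⟩ := hv c (by simp)
    rw [hr, hs]
    simp only [orient, vadd_eq_add, PiLp.add_apply, PiLp.smul_apply, smul_eq_mul]
    ring
  · intro h
    obtain rfl | hab := eq_or_ne a b
    · simpa using collinear_pair ℝ a c
    · obtain ⟨τ, hτ⟩ := exists_lineMap_eq_of_orient_eq_zero hab h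
      have hc : c ∈ line[ℝ, a, b] := hτ ▸ AffineMap.lineMap_mem_affineSpan_pair τ a b
      rw [Set.pair_comm b c, Set.insert_comm]
      exact collinear_insert_of_mem_affineSpan_pair hc

noncomputable local instance planeDecidableEq : DecidableEq Plane := Classical.decEq Plane

theorem affineIndependent_triple_iff {a b c : Plane} (hab : a ≠ b) (hac : a ≠ c) (hbc : b ≠ c) :
    AffineIndependent ℝ ((↑) : ({a, b, c} : Finset Plane) → Plane) ↔ orient a b c ≠ 0 := by
  rw [Ne, ← collinear_iff_orient, ← affineIndependent_iff_not_collinear_set]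
  have hinj : Function.Injective ![a, b, c] := by
    intro i j hij
    fin_cases i <;> fin_cases j <;> simp_all
  have hrange : Set.range ![a, b, c] = (({a, b, c} : Finset Plane) : Set Plane) := by
    simp only [Matrix.range_cons, Matrix.range_empty, Set.union_empty, Set.singleton_union,
      Finset.coe_insert, Finset.coe_singleton]
  constructor
  · intro h
    refine AffineIndependent.of_set_of_injective ?_ hinj
    rw [hrange]
    exact h
  · intro h
    have := h.range
    rw [hrange] at this
    exact this

/-- The vertex sets of nondegenerate triangles: affinely independent sets of three points. -/
def IsTriangle (t : Finset Plane) : Prop :=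
  t.card = 3 ∧ AffineIndependent ℝ ((↑) : t → Plane)

theorem isTriangle_of_orient_ne_zero {a b c : Plane} (h : orient a b c ≠ 0) :
    IsTriangle {a, b, c} := by
  obtain ⟨hab, hac, hbc⟩ := ne_of_orient_ne_zero h
  exact ⟨Finset.card_eq_three.2 ⟨a, b, c, hab, hac, hbc, rfl⟩,
    (affineIndependent_triple_iff hab hac hbc).2 h⟩

namespace IsTriangle

variable {t : Finset Plane}

theorem nonempty (ht : IsTriangle t) : t.Nonempty :=
  Finset.card_pos.1 (by rw [ht.1]; norm_num)

theorem exists_orient_pos (ht : IsTriangle t) :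
    ∃ a b c : Plane, t = {a, b, c} ∧ 0 < orient a b c := by
  obtain ⟨hcard, hind⟩ := ht
  obtain ⟨a, b, c, hab, hac, hbc, rfl⟩ := Finset.card_eq_three.1 hcard
  rw [affineIndependent_triple_iff hab hac hbc] at hind
  rcases lt_or_gt_of_ne hind with h | h
  · exact ⟨b, a, c, Finset.insert_comm a b {c}, by rw [orient_swap]; linarith⟩
  · exact ⟨a, b, c, rfl, h⟩

theorem exists_affineTriangle (ht : IsTriangle t) :
    ∃ T : Affine.Triangle ℝ Plane, (t : Set Plane) = Set.range T.points := by
  let e : Fin 3 ≃ t := (Fintype.equivFinOfCardEq (by rw [Fintype.card_coe, ht.1])).symm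
  refine ⟨⟨Subtype.val ∘ e, ht.2.comp_embedding e.toEmbedding⟩, ?_⟩
  simp

end IsTriangle

section Integration

open MeasureTheory

/-- The triangle with vertices `(0, 0)`, `(1, 0)`, `(0, 1)`, the domain of the affine coordinates
of an arbitrary triangle. -/
def cornerTriangle : Set (ℝ × ℝ) := {p | 0 ≤ p.1 ∧ 0 ≤ p.2 ∧ p.1 + p.2 ≤ 1}

theorem isCompact_cornerTriangle : IsCompact cornerTriangle := by
  have hclosed : IsClosed cornerTriangle :=
    (isClosed_le continuous_const continuous_fst).inter
      ((isClosed_le continuous_const continuous_snd).inter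
        (isClosed_le (continuous_fst.add continuous_snd) continuous_const))
  refine (isCompact_Icc (a := ((0 : ℝ), (0 : ℝ))) (b := (1, 1))).of_isClosed_subset hclosed ?_
  rintro ⟨s, t⟩ ⟨hs, ht, hst⟩
  dsimp only at hs ht hst
  exact ⟨⟨hs, ht⟩, ⟨by dsimp only; linarith, by dsimp only; linarith⟩⟩

variable {F : Type*} [NormedAddCommGroup F] [NormedSpace ℝ F]

theorem setIntegral_cornerTriangle {g : ℝ × ℝ → F} (hg : IntegrableOn g cornerTriangle) :
    ∫ p in cornerTriangle, g p = ∫ s in (0 : ℝ)..1, ∫ t in (0 : ℝ)..(1 - s), g (s, t) := by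
  have hmeas := isCompact_cornerTriangle.measurableSet
  have hslice : ∀ s ∈ Set.Icc (0 : ℝ) 1, ∀ t, cornerTriangle.indicator g (s, t) =
      (Set.Icc 0 (1 - s)).indicator (fun t => g (s, t)) t := fun s hs t => by
    have hmem : (s, t) ∈ cornerTriangle ↔ t ∈ Set.Icc 0 (1 - s) :=
      ⟨fun h => ⟨h.2.1, by linarith [h.2.2]⟩, fun h => ⟨hs.1, h.1, by dsimp only; linarith [h.2]⟩⟩
    by_cases ht : t ∈ Set.Icc 0 (1 - s)
    · rw [Set.indicator_of_mem ht, Set.indicator_of_mem (hmem.2 ht)]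
    · rw [Set.indicator_of_notMem ht, Set.indicator_of_notMem (mt hmem.1 ht)]
  have hempty : ∀ s ∉ Set.Icc (0 : ℝ) 1, ∀ t, cornerTriangle.indicator g (s, t) = 0 := by
    refine fun s hs t => Set.indicator_of_notMem (fun h => hs ⟨h.1, ?_⟩) _
    linarith [h.2.1, h.2.2]
  rw [← integral_indicator hmeas, Measure.volume_eq_prod,
    integral_prod _ ((integrable_indicator_iff hmeas).2 hg),
    intervalIntegral.integral_of_le zero_le_one, ← integral_Icc_eq_integral_Ioc,
    ← integral_indicator measurableSet_Icc]
  congr 1 with s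
  by_cases hs : s ∈ Set.Icc (0 : ℝ) 1
  · rw [Set.indicator_of_mem hs, intervalIntegral.integral_of_le (by linarith [hs.2]),
      ← integral_Icc_eq_integral_Ioc, ← integral_indicator measurableSet_Icc]
    simp only [hslice s hs]
  · simp only [Set.indicator_of_notMem hs, hempty s hs, integral_zero]

/-- The linear part of the affine coordinates on the triangle `a b c`: the linear map sending the
standard basis to the edge vectors `b - a` and `c - a`. -/
noncomputable def edgeMap (a b c : Plane) : Plane →L[ℝ] Plane :=
  (EuclideanSpace.proj 0 : Plane →L[ℝ] ℝ).smulRight (b - a) +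
    (EuclideanSpace.proj 1 : Plane →L[ℝ] ℝ).smulRight (c - a)

theorem edgeMap_apply (a b c x : Plane) :
    edgeMap a b c x = x 0 • (b - a) + x 1 • (c - a) := by
  simp [edgeMap]

theorem det_edgeMap (a b c : Plane) : (edgeMap a b c).det = orient a b c := by
  rw [ContinuousLinearMap.det,
    ← LinearMap.det_toMatrix (EuclideanSpace.basisFun (Fin 2) ℝ).toBasis, Matrix.det_fin_two]
  simp [LinearMap.toMatrix_apply, edgeMap_apply, orient]
  ring

theorem edgeMap_injective {a b c : Plane} (h : orient a b c ≠ 0) :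
    Function.Injective (edgeMap a b c) :=
  (LinearMap.equivOfDetNeZero (edgeMap a b c : Plane →ₗ[ℝ] Plane)
    (by rwa [← det_edgeMap] at h)).injective

theorem image_edgeMap (a b c : Plane) :
    (fun x => a + edgeMap a b c x) '' ((fun x : Plane => (x 0, x 1)) ⁻¹' cornerTriangle) =
      convexHull ℝ {a, b, c} := by
  ext y
  rw [mem_convexHull_triple]
  constructor
  · rintro ⟨x, ⟨h0, h1, h2⟩, rfl⟩
    dsimp only at h0 h1 h2
    refine ⟨1 - x 0 - x 1, x 0, x 1, by linarith, h0, h1, by ring, ?_⟩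
    simp only [edgeMap_apply]
    module
  · rintro ⟨α, β, γ, hα, hβ, hγ, h1, rfl⟩
    obtain rfl : α = 1 - β - γ := by linarith
    refine ⟨!₂[β, γ], ⟨hβ, hγ, by simp; linarith⟩, ?_⟩
    simp only [edgeMap_apply, Matrix.cons_val_zero, Matrix.cons_val_one]
    module

theorem setIntegral_triangle {a b c : Plane} (h : orient a b c ≠ 0) {f : Plane → F}
    (hf : Continuous f) :
    ∫ x in convexHull ℝ ({a, b, c} : Set Plane), f x =
      |orient a b c| • ∫ s in (0 : ℝ)..1, ∫ t in (0 : ℝ)..(1 - s),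
        f (a + s • (b - a) + t • (c - a)) := by
  set coords : Plane → ℝ × ℝ := fun x => (x 0, x 1)
  have hcoords : MeasurePreserving coords :=
    (volume_preserving_finTwoArrow ℝ).comp
      (EuclideanSpace.volume_preserving_symm_measurableEquiv_toLp (Fin 2))
  have hemb : MeasurableEmbedding coords :=
    ((MeasurableEquiv.toLp 2 (Fin 2 → ℝ)).symm.trans
      MeasurableEquiv.finTwoArrow).measurableEmbedding
  set g : ℝ × ℝ → F := fun p => f (a + p.1 • (b - a) + p.2 • (c - a))
  have hg : Continuous g := by fun_prop
  have hpull : ∀ x, f (a + edgeMap a b c x) = g (coords x) := fun x => by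
    simp only [g, coords, edgeMap_apply, add_assoc]
  rw [← image_edgeMap, integral_image_eq_integral_abs_det_fderiv_smul volume
    (hcoords.measurable isCompact_cornerTriangle.measurableSet)
    (fun x _ => ((edgeMap a b c).hasFDerivAt.const_add a).hasFDerivWithinAt)
    (((add_right_injective a).comp (edgeMap_injective h)).injOn)]
  simp only [det_edgeMap, hpull]
  rw [integral_smul, hcoords.setIntegral_preimage_emb hemb,
    setIntegral_cornerTriangle (hg.continuousOn.integrableOn_compact isCompact_cornerTriangle)]

theorem triangleArea_triple {a b c : Plane} (h : orient a b c ≠ 0) :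
    triangleArea {a, b, c} = |orient a b c| / 2 := by
  have harea := setIntegral_triangle h (continuous_const (y := (1 : ℝ)))
  have htri : ∫ x in (0 : ℝ)..1, (1 - x) = 1 / 2 := by
    rw [intervalIntegral.integral_sub (by simp) (by simp), integral_id]
    norm_num
  simp only [integral_const, smul_eq_mul, mul_one, intervalIntegral.integral_const, sub_zero,
    measureReal_restrict_apply_univ, htri] at harea
  rw [triangleArea, Finset.coe_insert, Finset.coe_pair, ← measureReal_def, harea]
  ring

theorem IsTriangle.area_pos {t : Finset Plane} (ht : IsTriangle t) : 0 < triangleArea t := by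
  obtain ⟨a, b, c, rfl, h⟩ := ht.exists_orient_pos
  rw [triangleArea_triple h.ne', abs_of_pos h]
  positivity

theorem integral_cubic (k₀ k₁ k₂ k₃ u : ℝ) :
    ∫ t in (0 : ℝ)..u, (k₀ + k₁ * t + k₂ * t ^ 2 + k₃ * t ^ 3) =
      k₀ * u + k₁ * u ^ 2 / 2 + k₂ * u ^ 3 / 3 + k₃ * u ^ 4 / 4 := by
  have hderiv (t : ℝ) : HasDerivAt
      (fun u : ℝ => k₀ * u + k₁ * u ^ 2 / 2 + k₂ * u ^ 3 / 3 + k₃ * u ^ 4 / 4)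
      (k₀ + k₁ * t + k₂ * t ^ 2 + k₃ * t ^ 3) t := by
    refine (((((hasDerivAt_id t).const_mul k₀).add
      (((hasDerivAt_pow 2 t).const_mul k₁).div_const 2)).add
      (((hasDerivAt_pow 3 t).const_mul k₂).div_const 3)).add
      (((hasDerivAt_pow 4 t).const_mul k₃).div_const 4)).congr_deriv ?_
    push_cast
    ring
  rw [intervalIntegral.integral_eq_sub_of_hasDerivAt (fun t _ => hderiv t)
    (Continuous.intervalIntegrable (by fun_prop) _ _)]
  ring

theorem setIntegral_triangle_dist_sq {a b c : Plane} (h : orient a b c ≠ 0) :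
    ∫ x in convexHull ℝ ({a, b, c} : Set Plane), dist x a ^ 2 =
      |orient a b c| / 12 * (dist b a ^ 2 + dist c a ^ 2 + inner ℝ (b - a) (c - a)) := by
  rw [setIntegral_triangle h (by fun_prop), smul_eq_mul, div_mul_eq_mul_div, mul_div_assoc]
  congr 1
  set P := dist b a ^ 2 with hP
  set Q := dist c a ^ 2 with hQ
  set D : ℝ := inner ℝ (b - a) (c - a)
  have hdist (s t : ℝ) : dist (a + s • (b - a) + t • (c - a)) a ^ 2 =
      s ^ 2 * P + 2 * s * D * t + Q * t ^ 2 + 0 * t ^ 3 := by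
    rw [hP, hQ, dist_eq_norm, dist_eq_norm, dist_eq_norm, add_assoc, add_sub_cancel_left,
      norm_add_sq_real, real_inner_smul_left, real_inner_smul_right, norm_smul, norm_smul,
      mul_pow, mul_pow, Real.norm_eq_abs, Real.norm_eq_abs, sq_abs, sq_abs]
    ring
  have hinner (s : ℝ) : s ^ 2 * P * (1 - s) + 2 * s * D * (1 - s) ^ 2 / 2 +
      Q * (1 - s) ^ 3 / 3 + 0 * (1 - s) ^ 4 / 4 =
      Q / 3 + (D - Q) * s + (P - 2 * D + Q) * s ^ 2 + (D - P - Q / 3) * s ^ 3 := by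
    ring
  simp only [hdist, integral_cubic, hinner]
  ring

end Integration

theorem circumradius_sq_mul_orient_sq {a b c o : Plane} {r : ℝ} (ha : dist a o = r)
    (hb : dist b o = r) (hc : dist c o = r) :
    4 * r ^ 2 * orient a b c ^ 2 = (dist a b * dist b c * dist c a) ^ 2 := by
  have ea := dist_sq_plane a o
  have eb := dist_sq_plane b o
  have ec := dist_sq_plane c o
  rw [ha] at ea
  rw [hb] at eb
  rw [hc] at ec
  rw [mul_pow, mul_pow, dist_sq_plane, dist_sq_plane, dist_sq_plane]
  unfold orient
  generalize a 0 = a0, a 1 = a1, b 0 = b0, b 1 = b1, c 0 = c0, c 1 = c1, o 0 = o0, o 1 = o1 at *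
  set X := (b0 - a0) * (c1 - a1) - (b1 - a1) * (c0 - a0) with hX
  set B := (b0 - a0) ^ 2 + (b1 - a1) ^ 2 with hB
  set C := (c0 - a0) ^ 2 + (c1 - a1) ^ 2 with hC
  have bisector_ab : 2 * (o0 - a0) * (b0 - a0) + 2 * (o1 - a1) * (b1 - a1) = B := by
    rw [hB]; linear_combination eb - ea
  have bisector_ac : 2 * (o0 - a0) * (c0 - a0) + 2 * (o1 - a1) * (c1 - a1) = C := by
    rw [hC]; linear_combination ec - ea
  have cramer₀ : 2 * (o0 - a0) * X = B * (c1 - a1) - C * (b1 - a1) := by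
    rw [hX, ← bisector_ab, ← bisector_ac]; ring
  have cramer₁ : 2 * (o1 - a1) * X = C * (b0 - a0) - B * (c0 - a0) := by
    rw [hX, ← bisector_ab, ← bisector_ac]; ring
  calc 4 * r ^ 2 * X ^ 2 = (2 * (o0 - a0) * X) ^ 2 + (2 * (o1 - a1) * X) ^ 2 := by rw [ea]; ring
    _ = _ := by rw [cramer₀, cramer₁, hB, hC]; ring

namespace IsTriangle

variable {t : Finset Plane}

theorem exists_circumcircle (ht : IsTriangle t) :
    ∃ o : Plane, ∀ p ∈ t, dist p o = triangleCircumradius t := by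
  obtain ⟨T, hT⟩ := ht.exists_affineTriangle
  refine ⟨T.circumcenter, fun p hp => ?_⟩
  obtain ⟨i, rfl⟩ : p ∈ Set.range T.points := hT ▸ hp
  rw [triangleCircumradius_eq T t hT, T.dist_circumcenter_eq_circumradius]

theorem circumradius_nonneg (ht : IsTriangle t) : 0 ≤ triangleCircumradius t := by
  obtain ⟨o, ho⟩ := ht.exists_circumcircle
  obtain ⟨p, hp⟩ := ht.nonempty
  exact ho p hp ▸ dist_nonneg

theorem circumradius_eq (ht : IsTriangle t) {o : Plane} {r : ℝ} (ho : ∀ p ∈ t, dist p o = r) :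
    triangleCircumradius t = r := by
  obtain ⟨T, hT⟩ := ht.exists_affineTriangle
  have hspan : affineSpan ℝ (Set.range T.points) = ⊤ :=
    T.independent.affineSpan_eq_top_iff_card_eq_finrank_add_one.2 (by simp)
  rw [triangleCircumradius_eq T t hT]
  refine (T.eq_circumradius_of_dist_eq (by rw [hspan]; trivial) fun i => ho _ ?_).symm
  exact Finset.mem_coe.1 (hT ▸ Set.mem_range_self i)

end IsTriangle

theorem edgeLength_pair (a b : Plane) : edgeLength {a, b} = dist a b := by
  rw [edgeLength, Finset.coe_pair, Metric.diam_pair]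

theorem triangleEdges_triple {a b c : Plane} (hab : a ≠ b) (hac : a ≠ c) (hbc : b ≠ c) :
    triangleEdges {a, b, c} = {{a, b}, {b, c}, {c, a}} := by
  ext e
  simp only [triangleEdges, Finset.mem_powersetCard, Finset.mem_insert, Finset.mem_singleton]
  constructor
  · rintro ⟨hsub, hcard⟩
    obtain ⟨x, y, hxy, rfl⟩ := Finset.card_eq_two.1 hcard
    have hx := hsub (Finset.mem_insert_self x {y})
    have hy := hsub (Finset.mem_insert_of_mem (Finset.mem_singleton_self y))
    simp only [Finset.mem_insert, Finset.mem_singleton] at hx hy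
    rcases hx with rfl | rfl | rfl <;> rcases hy with rfl | rfl | rfl <;>
      simp_all [Finset.pair_comm]
  · grind

@[to_additive]
theorem prod_triangleEdges {M : Type*} [CommMonoid M] {a b c : Plane} (hab : a ≠ b) (hac : a ≠ c)
    (hbc : b ≠ c) (f : Finset Plane → M) :
    ∏ e ∈ triangleEdges {a, b, c}, f e = f {a, b} * f {b, c} * f {c, a} := by
  have hne (x y z : Plane) (hxy : x ≠ y) (hxz : x ≠ z) : ({x, y} : Finset Plane) ≠ {y, z} :=
    fun h => by
      have hx : x ∈ ({y, z} : Finset Plane) := h ▸ Finset.mem_insert_self x {y}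
      simp [hxy, hxz] at hx
  rw [triangleEdges_triple hab hac hbc, Finset.prod_insert, Finset.prod_pair, mul_assoc]
  · exact hne b c a hbc hab.symm
  · simp only [Finset.mem_insert, Finset.mem_singleton, not_or]
    exact ⟨hne a b c hab hac, (hne c a b hac.symm hbc.symm).symm⟩

theorem prodEdges_triple {a b c : Plane} (hab : a ≠ b) (hac : a ≠ c) (hbc : b ≠ c) :
    prodEdges {a, b, c} = dist a b * dist b c * dist c a := by
  simp only [prodEdges, prod_triangleEdges hab hac hbc, edgeLength_pair]

theorem sumSqEdges_triple {a b c : Plane} (hab : a ≠ b) (hac : a ≠ c) (hbc : b ≠ c) :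
    sumSqEdges {a, b, c} = dist a b ^ 2 + dist b c ^ 2 + dist c a ^ 2 := by
  simp only [sumSqEdges, sum_triangleEdges hab hac hbc, edgeLength_pair]

theorem IsTriangle.circumradius_mul_area {t : Finset Plane} (ht : IsTriangle t) :
    triangleCircumradius t * triangleArea t = 1 / 4 * prodEdges t := by
  have hR := ht.circumradius_nonneg
  obtain ⟨o, ho⟩ := ht.exists_circumcircle
  obtain ⟨a, b, c, rfl, h⟩ := ht.exists_orient_pos
  obtain ⟨hab, hac, hbc⟩ := ne_of_orient_ne_zero h.ne'
  rw [triangleArea_triple h.ne', abs_of_pos h, prodEdges_triple hab hac hbc]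
  have hsq := circumradius_sq_mul_orient_sq (ho a (by simp)) (ho b (by simp)) (ho c (by simp))
  have : 2 * triangleCircumradius {a, b, c} * orient a b c = dist a b * dist b c * dist c a := by
    rw [← sq_eq_sq₀ (by positivity) (by positivity)]
    linear_combination hsq
  linear_combination this / 4

/-- The contribution `R ^ α * area` of one triangle to the functional `R_α`. -/
noncomputable def radiusWeight (α : ℝ) (t : Finset Plane) : ℝ :=
  triangleCircumradius t ^ α * triangleArea t

theorem IsTriangle.radiusWeight_nonneg {t : Finset Plane} (ht : IsTriangle t) (α : ℝ) :
    0 ≤ radiusWeight α t :=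
  mul_nonneg (Real.rpow_nonneg ht.circumradius_nonneg α) ht.area_pos.le

theorem IsTriangle.radiusWeight_one {t : Finset Plane} (ht : IsTriangle t) :
    radiusWeight 1 t = 1 / 4 * prodEdges t := by
  rw [radiusWeight, Real.rpow_one, ht.circumradius_mul_area]

theorem radiusWeight_one_triple {a b c : Plane} (h : orient a b c ≠ 0) :
    radiusWeight 1 {a, b, c} = 1 / 4 * (dist a b * dist b c * dist c a) := by
  obtain ⟨hab, hac, hbc⟩ := ne_of_orient_ne_zero h
  rw [(isTriangle_of_orient_ne_zero h).radiusWeight_one, prodEdges_triple hab hac hbc]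

theorem radiusWeight_two_triple {a b c : Plane} (h : orient a b c ≠ 0) :
    radiusWeight 2 {a, b, c} = (dist a b * dist b c * dist c a) ^ 2 / (8 * |orient a b c|) := by
  have hone := radiusWeight_one_triple h
  rw [radiusWeight, Real.rpow_one, triangleArea_triple h] at hone
  rw [radiusWeight, triangleArea_triple h, Real.rpow_two, show dist a b * dist b c * dist c a =
    4 * (triangleCircumradius {a, b, c} * (|orient a b c| / 2)) by rw [hone]; ring]
  have : |orient a b c| ≠ 0 := abs_ne_zero.2 h
  field_simp
  ring

section Quadrilateral

variable {E : Type*} [NormedAddCommGroup E] [InnerProductSpace ℝ E] {a b c d : E} {α β γ δ : ℝ}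

theorem exists_eq_add_smul_of_diagonals_cross {𝕜 E : Type*} [CommRing 𝕜] [AddCommGroup E]
    [Module 𝕜 E] {a b c d : E} {α β γ δ : 𝕜} (hαβ : α + β = 1) (hγδ : γ + δ = 1)
    (hcross : α • a + β • b = γ • c + δ • d) :
    ∃ z u v : E, a = z + β • u ∧ b = z - α • u ∧ c = z + δ • v ∧ d = z - γ • v := by
  obtain rfl : α = 1 - β := eq_sub_of_add_eq hαβ
  obtain rfl : γ = 1 - δ := eq_sub_of_add_eq hγδ
  refine ⟨(1 - β) • a + β • b, a - b, c - d, by module, by module, ?_, ?_⟩ <;>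
  · rw [hcross]
    module

/- The right-hand side is the difference of the powers of the crossing point with respect to the
circles having the two diagonals as chords. -/
theorem inner_add_inner_of_diagonals_cross (hαβ : α + β = 1) (hγδ : γ + δ = 1)
    (hcross : α • a + β • b = γ • c + δ • d) :
    γ * inner ℝ (a - c) (b - c) + δ * inner ℝ (a - d) (b - d) =
      γ * δ * dist c d ^ 2 - α * β * dist a b ^ 2 := by
  obtain ⟨z, u, v, rfl, rfl, rfl, rfl⟩ :=
    exists_eq_add_smul_of_diagonals_cross hαβ hγδ hcross
  obtain rfl : α = 1 - β := by linarith
  obtain rfl : γ = 1 - δ := by linarith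
  simp only [dist_eq_norm, ← real_inner_self_eq_norm_sq, inner_sub_left, inner_sub_right,
    inner_add_left, inner_add_right, real_inner_smul_left, real_inner_smul_right,
    real_inner_comm u v, real_inner_comm z u, real_inner_comm z v]
  ring

/- Over `8 * (α * β * γ * δ) * X`, where `X` is the cross product of the diagonals, the left-hand
side is the change of `∑ R ^ 2 * area` under the flip. -/
theorem dist_products_of_diagonals_cross (hαβ : α + β = 1) (hγδ : γ + δ = 1)
    (hcross : α • a + β • b = γ • c + δ • d) :
    α * β * dist a b ^ 2 * (γ * (dist b c * dist c a) ^ 2 + δ * (dist b d * dist d a) ^ 2) -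
        γ * δ * dist c d ^ 2 * (α * (dist d a * dist a c) ^ 2 + β * (dist d b * dist b c) ^ 2) =
      (α * β * dist a b ^ 2 - γ * δ * dist c d ^ 2) *
        ((α * β * dist a b ^ 2 - γ * δ * dist c d ^ 2) ^ 2 +
          4 * (α * β * γ * δ) * (dist a b ^ 2 * dist c d ^ 2 - inner ℝ (a - b) (c - d) ^ 2)) := by
  obtain ⟨z, u, v, rfl, rfl, rfl, rfl⟩ :=
    exists_eq_add_smul_of_diagonals_cross hαβ hγδ hcross
  obtain rfl : α = 1 - β := by linarith
  obtain rfl : γ = 1 - δ := by linarith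
  simp only [mul_pow, dist_eq_norm, ← real_inner_self_eq_norm_sq, inner_sub_left, inner_sub_right,
    inner_add_left, inner_add_right, real_inner_smul_left, real_inner_smul_right,
    real_inner_comm u v, real_inner_comm z u, real_inner_comm z v]
  ring

end Quadrilateral

theorem cos_add_cos_pos_of_sin_add_pos {x y : ℝ} (hx : 0 ≤ x) (hxπ : x ≤ Real.pi) (hy : 0 ≤ y)
    (hyπ : y ≤ Real.pi) (h : 0 < Real.sin (x + y)) : 0 < Real.cos x + Real.cos y := by
  have hsum : x + y < Real.pi := by
    by_contra! hle
    have := Real.sin_nonneg_of_nonneg_of_le_pi (x := x + y - Real.pi) (by linarith) (by linarith)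
    rw [Real.sin_sub_pi] at this
    linarith
  have := Real.cos_lt_cos_of_nonneg_of_le_pi hx (by linarith) (show x < Real.pi - y by linarith)
  rw [Real.cos_pi_sub] at this
  linarith

theorem sin_angle_mul_dist_mul_dist (a b c : Plane) :
    Real.sin (∠ a c b) * (dist a c * dist b c) = |orient a b c| := by
  rw [angle, dist_eq_norm, dist_eq_norm, vsub_eq_sub, vsub_eq_sub,
    InnerProductGeometry.sin_angle_mul_norm_mul_norm, ← Real.sqrt_sq_eq_abs]
  congr 1
  simp only [EuclideanSpace.inner_eq_star_dotProduct, dotProduct, Fin.sum_univ_two, orient,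
    PiLp.sub_apply, Pi.star_apply, star_trivial]
  ring

theorem cos_add_cos_neg_of_sin_add_neg {x y : ℝ} (hx : 0 ≤ x) (hxπ : x ≤ Real.pi) (hy : 0 ≤ y)
    (hyπ : y ≤ Real.pi) (h : Real.sin (x + y) < 0) : Real.cos x + Real.cos y < 0 := by
  have := cos_add_cos_pos_of_sin_add_pos (sub_nonneg.2 hxπ) (sub_le_self _ hx) (sub_nonneg.2 hyπ)
    (sub_le_self _ hy)
    (by rwa [show Real.pi - x + (Real.pi - y) = 2 * Real.pi - (x + y) by ring,
      Real.sin_two_pi_sub, neg_pos])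
  rw [Real.cos_pi_sub, Real.cos_pi_sub] at this
  linarith

theorem cos_angle_mul_dist_mul_dist {E : Type*} [NormedAddCommGroup E] [InnerProductSpace ℝ E]
    (a b c : E) : Real.cos (∠ a c b) * (dist a c * dist b c) =
      inner ℝ (a - c) (b - c) := by
  rw [angle, dist_eq_norm, dist_eq_norm, vsub_eq_sub, vsub_eq_sub,
    InnerProductGeometry.cos_angle_mul_norm_mul_norm]

theorem sin_angle_add_angle_mul_dist (a b c d : Plane) :
    Real.sin (∠ a c b + ∠ a d b) *
        (dist a c * dist b c * (dist a d * dist b d)) =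
      |orient a b c| * inner ℝ (a - d) (b - d) + inner ℝ (a - c) (b - c) * |orient a b d| := by
  rw [Real.sin_add, ← sin_angle_mul_dist_mul_dist, ← sin_angle_mul_dist_mul_dist,
    ← cos_angle_mul_dist_mul_dist, ← cos_angle_mul_dist_mul_dist]
  ring

/- With `p`, `q`, `r`, `s` the sides and `e`, `f` the diagonals of a quadrilateral, the hypotheses
are the law of cosines at its four vertices. Both sides of the claim are compared, after squaring,
with the symmetric expression `p * r + q * s`. -/
theorem diagonal_mul_lt_diagonal_mul {p q r s e f k₁ k₂ k₃ k₄ : ℝ} (hp : 0 < p) (hq : 0 < q)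
    (hr : 0 < r) (hs : 0 < s) (he : 0 < e)
    (h₁ : e ^ 2 = p ^ 2 + q ^ 2 - 2 * (p * q * k₁)) (h₂ : e ^ 2 = r ^ 2 + s ^ 2 - 2 * (r * s * k₂))
    (h₃ : f ^ 2 = p ^ 2 + s ^ 2 - 2 * (p * s * k₃)) (h₄ : f ^ 2 = q ^ 2 + r ^ 2 - 2 * (q * r * k₄))
    (h₁₂ : k₁ + k₂ < 0) (h₃₄ : 0 < k₃ + k₄) :
    f * (p * s + q * r) < e * (p * q + r * s) := by
  have he_gt : (p * r + q * s) * (p * s + q * r) < e ^ 2 * (p * q + r * s) := by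
    linear_combination (2 * (p * q * r * s)) * h₁₂ - r * s * h₁ - p * q * h₂
  have hf_lt : f ^ 2 * (p * s + q * r) < (p * r + q * s) * (p * q + r * s) := by
    linear_combination (2 * (p * q * r * s)) * h₃₄ + q * r * h₃ + p * s * h₄
  apply lt_of_pow_lt_pow_left₀ 2 (by positivity)
  calc (f * (p * s + q * r)) ^ 2
      = f ^ 2 * (p * s + q * r) * (p * s + q * r) := by ring
    _ < (p * r + q * s) * (p * q + r * s) * (p * s + q * r) := by gcongr
    _ = (p * r + q * s) * (p * s + q * r) * (p * q + r * s) := by ring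
    _ < e ^ 2 * (p * q + r * s) * (p * q + r * s) := by gcongr
    _ = (e * (p * q + r * s)) ^ 2 := by ring

/-- A convex quadrilateral `a c b d` whose diagonals `a b` and `c d` cross in the point
`α • a + β • b = γ • c + δ • d`, and in which the diagonal `a b` can be flipped to `c d`: by the
inequality `power_lt` between the powers of the crossing point, `d` is inside the circle through
`a`, `b`, `c`. -/
structure FlippableQuad (a b c d : Plane) (α β γ δ : ℝ) : Prop where
  α_pos : 0 < α
  β_pos : 0 < β
  γ_pos : 0 < γ
  δ_pos : 0 < δ
  α_add_β : α + β = 1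
  γ_add_δ : γ + δ = 1
  cross : α • a + β • b = γ • c + δ • d
  orient_pos : 0 < orient a b c
  power_lt : γ * δ * dist c d ^ 2 < α * β * dist a b ^ 2

namespace FlippableQuad

variable {a b c d : Plane} {α β γ δ : ℝ}

theorem exists_orient_eq (h : FlippableQuad a b c d α β γ δ) :
    ∃ X : ℝ, 0 < X ∧ orient a b c = δ * X ∧ orient a b d = -(γ * X) ∧ orient c d a = -(β * X) ∧
      orient c d b = α * X := by
  have hX : orient a b c = δ * ((c 0 - d 0) * (a 1 - b 1) - (c 1 - d 1) * (a 0 - b 0)) ∧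
      orient a b d = -(γ * ((c 0 - d 0) * (a 1 - b 1) - (c 1 - d 1) * (a 0 - b 0))) ∧
      orient c d a = -(β * ((c 0 - d 0) * (a 1 - b 1) - (c 1 - d 1) * (a 0 - b 0))) ∧
      orient c d b = α * ((c 0 - d 0) * (a 1 - b 1) - (c 1 - d 1) * (a 0 - b 0)) := by
    obtain ⟨z, u, v, rfl, rfl, rfl, rfl⟩ :=
      exists_eq_add_smul_of_diagonals_cross h.α_add_β h.γ_add_δ h.cross
    have hα : α = 1 - β := by linarith [h.α_add_β]
    have hγ : γ = 1 - δ := by linarith [h.γ_add_δ]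
    simp only [orient, PiLp.add_apply, PiLp.sub_apply, PiLp.smul_apply, smul_eq_mul, hα, hγ]
    refine ⟨?_, ?_, ?_, ?_⟩ <;> ring
  exact ⟨_, pos_of_mul_pos_right (hX.1 ▸ h.orient_pos) h.δ_pos.le, hX⟩

theorem orient_ne_zero (h : FlippableQuad a b c d α β γ δ) :
    orient a b c ≠ 0 ∧ orient a b d ≠ 0 ∧ orient c d a ≠ 0 ∧ orient c d b ≠ 0 := by
  obtain ⟨X, hX, habc, habd, hcda, hcdb⟩ := h.exists_orient_eq
  rw [habc, habd, hcda, hcdb, neg_ne_zero, neg_ne_zero]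
  exact ⟨(mul_pos h.δ_pos hX).ne', (mul_pos h.γ_pos hX).ne', (mul_pos h.β_pos hX).ne',
    (mul_pos h.α_pos hX).ne'⟩

/- The sum of the angles opposite to `a b` exceeds `π` and the sum of the angles opposite to `c d`
is less than `π`: this is the meaning of `power_lt` in terms of angles. -/
theorem cos_add_cos_neg (h : FlippableQuad a b c d α β γ δ) :
    Real.cos (∠ a c b) + Real.cos (∠ a d b) < 0 := by
  obtain ⟨X, hX, habc, habd, -, -⟩ := h.exists_orient_eq
  refine cos_add_cos_neg_of_sin_add_neg (angle_nonneg _ _ _)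
    (angle_le_pi _ _ _) (angle_nonneg _ _ _)
    (angle_le_pi _ _ _) (neg_of_mul_neg_left ?_ (by positivity :
      0 ≤ dist a c * dist b c * (dist a d * dist b d)))
  rw [sin_angle_add_angle_mul_dist, habc, habd, abs_neg, abs_of_pos (mul_pos h.δ_pos hX),
    abs_of_pos (mul_pos h.γ_pos hX)]
  linear_combination X * h.power_lt +
    X * inner_add_inner_of_diagonals_cross h.α_add_β h.γ_add_δ h.cross

theorem cos_add_cos_pos (h : FlippableQuad a b c d α β γ δ) :
    0 < Real.cos (∠ c a d) + Real.cos (∠ c b d) := by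
  obtain ⟨X, hX, -, -, hcda, hcdb⟩ := h.exists_orient_eq
  refine cos_add_cos_pos_of_sin_add_pos (angle_nonneg _ _ _)
    (angle_le_pi _ _ _) (angle_nonneg _ _ _)
    (angle_le_pi _ _ _) (pos_of_mul_pos_left ?_ (by positivity :
      0 ≤ dist c a * dist d a * (dist c b * dist d b)))
  rw [sin_angle_add_angle_mul_dist, hcda, hcdb, abs_neg, abs_of_pos (mul_pos h.β_pos hX),
    abs_of_pos (mul_pos h.α_pos hX)]
  linear_combination X * h.power_lt -
    X * inner_add_inner_of_diagonals_cross h.γ_add_δ h.α_add_β h.cross.symm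

theorem radiusWeight_one_lt (h : FlippableQuad a b c d α β γ δ) :
    radiusWeight 1 {c, d, a} + radiusWeight 1 {c, d, b} <
      radiusWeight 1 {a, b, c} + radiusWeight 1 {a, b, d} := by
  obtain ⟨habc, habd, hcda, hcdb⟩ := h.orient_ne_zero
  rw [radiusWeight_one_triple habc, radiusWeight_one_triple habd, radiusWeight_one_triple hcda,
    radiusWeight_one_triple hcdb]
  obtain ⟨hab, hac, hbc⟩ := ne_of_orient_ne_zero habc
  obtain ⟨-, had, hbd⟩ := ne_of_orient_ne_zero habd
  have hlaw (x y z : Plane) : dist x z ^ 2 = dist x y ^ 2 + dist z y ^ 2 -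
      2 * (dist x y * dist z y * Real.cos (∠ x y z)) := by
    linear_combination law_cos x y z
  have hlt := diagonal_mul_lt_diagonal_mul (dist_pos.2 hac) (dist_pos.2 hbc) (dist_pos.2 hbd)
    (dist_pos.2 had) (dist_pos.2 hab) (hlaw a c b)
    (by simpa only [add_comm, mul_comm] using hlaw a d b)
    (by simpa only [dist_comm] using hlaw c a d) (by simpa only [dist_comm] using hlaw c b d)
    h.cos_add_cos_neg h.cos_add_cos_pos
  rw [dist_comm d a, dist_comm d b, dist_comm c a, dist_comm b c, dist_comm a c] at *
  linear_combination hlt / 4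

theorem radiusWeight_two_lt (h : FlippableQuad a b c d α β γ δ) :
    radiusWeight 2 {c, d, a} + radiusWeight 2 {c, d, b} <
      radiusWeight 2 {a, b, c} + radiusWeight 2 {a, b, d} := by
  obtain ⟨X, hX, habc, habd, hcda, hcdb⟩ := h.exists_orient_eq
  obtain ⟨habc₀, habd₀, hcda₀, hcdb₀⟩ := h.orient_ne_zero
  obtain ⟨hα, hβ, hγ, hδ, hαβ, hγδ, hcross, -, hpower⟩ := h
  have hpos : 0 < (α * β * dist a b ^ 2 - γ * δ * dist c d ^ 2) *
      ((α * β * dist a b ^ 2 - γ * δ * dist c d ^ 2) ^ 2 +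
        4 * (α * β * γ * δ) * (dist a b ^ 2 * dist c d ^ 2 - inner ℝ (a - b) (c - d) ^ 2)) := by
    have hcauchy : inner ℝ (a - b) (c - d) ^ 2 ≤ dist a b ^ 2 * dist c d ^ 2 := by
      rw [← mul_pow, ← sq_abs, dist_eq_norm, dist_eq_norm]
      exact pow_le_pow_left₀ (abs_nonneg _) (abs_real_inner_le_norm _ _) 2
    have := sub_pos.2 hpower
    have := sub_nonneg.2 hcauchy
    positivity
  rw [← dist_products_of_diagonals_cross hαβ hγδ hcross] at hpos
  rw [radiusWeight_two_triple habc₀, radiusWeight_two_triple habd₀, radiusWeight_two_triple hcda₀,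
    radiusWeight_two_triple hcdb₀, habc, habd, hcda, hcdb, abs_neg, abs_neg,
    abs_of_pos (mul_pos hδ hX), abs_of_pos (mul_pos hγ hX), abs_of_pos (mul_pos hβ hX),
    abs_of_pos (mul_pos hα hX), ← sub_pos]
  have hscale : 0 < 8 * (α * β * γ * δ) * X := by positivity
  refine (div_pos hpos hscale).trans_eq ?_
  field_simp

end FlippableQuad

section Generic

variable {E : Type*} [NormedAddCommGroup E] [NormedSpace ℝ E]

/-- A point is generic with respect to `S` if it is on no line through two points of `S`. The two
points are allowed to coincide, so a generic point is not in `S` either. -/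
def IsGeneric (S : Finset E) (x : E) : Prop :=
  ∀ p ∈ S, ∀ q ∈ S, x ∉ line[ℝ, p, q]

variable {S : Finset E} {x : E}

theorem IsGeneric.notMem_convexHull {e : Finset E} (hx : IsGeneric S x) (he : e ⊆ S)
    (hcard : e.card ≤ 2) : x ∉ convexHull ℝ (e : Set E) := by
  classical
  intro hxe
  obtain rfl | hne := e.eq_empty_or_nonempty
  · simp at hxe
  obtain ⟨p, q, rfl⟩ : ∃ p q, e = {p, q} := by
    rcases eq_or_lt_of_le (Nat.one_le_iff_ne_zero.2 (Finset.card_ne_zero.2 hne)) with h | h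
    · obtain ⟨p, rfl⟩ := Finset.card_eq_one.1 h.symm
      exact ⟨p, p, by simp⟩
    · obtain ⟨p, q, -, h⟩ := Finset.card_eq_two.1 (hcard.antisymm h)
      exact ⟨p, q, h⟩
  rw [Finset.coe_pair] at hxe
  exact hx p (he (by simp)) q (he (by simp)) (convexHull_subset_affineSpan _ hxe)

theorem IsGeneric.exists_pos_weights {t : Finset E} (hx : IsGeneric S x) (ht : t ⊆ S)
    (hcard : t.card ≤ 3) (hxt : x ∈ convexHull ℝ (t : Set E)) :
    ∃ w : E → ℝ, (∀ p ∈ t, 0 < w p) ∧ ∑ p ∈ t, w p = 1 ∧ ∑ p ∈ t, w p • p = x := by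
  classical
  obtain ⟨w, hw_nonneg, hw_sum, hwx⟩ := Finset.mem_convexHull'.1 hxt
  refine ⟨w, fun p hp => (hw_nonneg p hp).lt_of_ne' fun hwp => ?_, hw_sum, hwx⟩
  refine hx.notMem_convexHull ((t.erase_subset p).trans ht)
    (by rw [Finset.card_erase_of_mem hp]; omega)
    (Finset.mem_convexHull'.2 ⟨w, fun y hy => hw_nonneg y (Finset.mem_of_mem_erase hy), ?_, ?_⟩)
  · rw [← hw_sum, ← Finset.add_sum_erase _ _ hp, hwp, zero_add]
  · rw [← hwx, ← Finset.add_sum_erase _ _ hp, hwp, zero_smul, zero_add]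

theorem IsGeneric.eventually_lineMap (hx : IsGeneric S x) (y : E) :
    ∀ᶠ τ in 𝓝[>] (0 : ℝ), IsGeneric S (AffineMap.lineMap y x τ) := by
  simp only [IsGeneric, Finset.eventually_all]
  intro p hp q hq
  by_cases hy : y ∈ line[ℝ, p, q]
  · filter_upwards [self_mem_nhdsWithin] with τ hτ hmem
    have hx_eq : AffineMap.lineMap y (AffineMap.lineMap y x τ) τ⁻¹ = x := by
      rw [AffineMap.lineMap_lineMap_right, inv_mul_cancel₀ (ne_of_gt hτ),
        AffineMap.lineMap_apply_one]
    exact hx p hp q hq (hx_eq ▸ AffineMap.lineMap_mem _ hy hmem)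
  · have hopen : IsOpen (line[ℝ, p, q] : Set E)ᶜ :=
      (AffineSubspace.closed_of_finiteDimensional _).isOpen_compl
    exact (AffineMap.lineMap_continuous.continuousAt.eventually
      (hopen.mem_nhds (by simpa using hy))).filter_mono nhdsWithin_le_nhds

theorem affineSpan_ne_top_of_collinear (hE : 1 < Module.finrank ℝ E) {s : Set E}
    (hs : Collinear ℝ s) : affineSpan ℝ s ≠ ⊤ := by
  intro h
  have := hs.finiteDimensional_vectorSpan
  have hle := collinear_iff_finrank_le_one.1 hs
  rw [← direction_affineSpan, h, AffineSubspace.direction_top, finrank_top] at hle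
  exact hE.not_ge hle

theorem ae_isGeneric [FiniteDimensional ℝ E] [MeasurableSpace E] [BorelSpace E] (μ : Measure E)
    [μ.IsAddHaarMeasure] (hE : 1 < Module.finrank ℝ E) (S : Finset E) :
    ∀ᵐ x ∂μ, IsGeneric S x := by
  simp only [IsGeneric, ← Finset.mem_coe, ae_ball_iff S.countable_toSet]
  exact fun p _ q _ => measure_eq_zero_iff_ae_notMem.1
    (Measure.addHaar_affineSubspace _ _ (affineSpan_ne_top_of_collinear hE (collinear_pair ℝ p q)))

end Generic

theorem ae_plane_isGeneric (S : Finset Plane) : ∀ᵐ x : Plane, IsGeneric S x :=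
  ae_isGeneric volume (by simp) S

theorem IsTriangle.exists_isGeneric {t : Finset Plane} (ht : IsTriangle t) (S : Finset Plane) :
    ∃ x ∈ convexHull ℝ (t : Set Plane), IsGeneric S x := by
  by_contra! h
  have hnull : volume (convexHull ℝ (t : Set Plane)) = 0 :=
    measure_mono_null h (ae_plane_isGeneric S)
  exact ht.area_pos.ne' (by rw [triangleArea, hnull, ENNReal.toReal_zero])

theorem isCompact_convexHull_finset {E : Type*} [NormedAddCommGroup E] [NormedSpace ℝ E]
    (t : Finset E) : IsCompact (convexHull ℝ (t : Set E)) :=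
  t.finite_toSet.isCompact_convexHull ℝ

/-- A finite set of triangles that triangulates the convex hull of `S`: a geometric triangulation of
`S` given by its triangles only. Covering is required for generic points only, because this is
preserved by flips for simple reasons; `IsTriangulation.exists_mem` recovers the other points as
soon as `S` spans a triangle. If `S` is collinear, then `T = ∅` is a triangulation. -/
structure IsTriangulation (S : Finset Plane) (T : Finset (Finset Plane)) : Prop where
  subset : ∀ t ∈ T, t ⊆ S
  isTriangle : ∀ t ∈ T, IsTriangle t
  inter_subset : ∀ t ∈ T, ∀ t' ∈ T,
    convexHull ℝ (t : Set Plane) ∩ convexHull ℝ (t' : Set Plane) ⊆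
      convexHull ℝ ((t : Set Plane) ∩ t')
  mem_of_mem_convexHull : ∀ t ∈ T, ∀ q ∈ S, q ∈ convexHull ℝ (t : Set Plane) → q ∈ t
  cover : ∀ x ∈ convexHull ℝ (S : Set Plane), IsGeneric S x →
    ∃ t ∈ T, x ∈ convexHull ℝ (t : Set Plane)

theorem card_le_three_of_affineIndependent {t : Finset Plane}
    (ht : AffineIndependent ℝ ((↑) : t → Plane)) : t.card ≤ 3 := by
  have hcard := ht.card_le_finrank_succ
  have hdim := Submodule.finrank_le (vectorSpan ℝ (Set.range ((↑) : t → Plane)))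
  rw [Fintype.card_coe] at hcard
  rw [finrank_euclideanSpace_fin] at hdim
  omega

namespace GeometricTriangulation

variable {S : Finset Plane} (K : GeometricTriangulation S)

theorem singleton_mem_faces {p : Plane} : {p} ∈ K.faces ↔ p ∈ S := by
  rw [← Finset.mem_coe, ← K.vertices_eq]
  rfl

theorem subset_of_mem_faces {t : Finset Plane} (ht : t ∈ K.faces) : t ⊆ S := fun p hp =>
  K.singleton_mem_faces.1
    (K.down_closed ht (Finset.singleton_subset_iff.2 hp) (Finset.singleton_nonempty p))

theorem mem_of_mem_convexHull {t : Finset Plane} (ht : t ∈ K.faces) {q : Plane} (hq : q ∈ S)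
    (hqt : q ∈ convexHull ℝ (t : Set Plane)) : q ∈ t := by
  have hinter := K.inter_subset_convexHull (K.singleton_mem_faces.2 hq) ht
    ⟨subset_convexHull ℝ _ (by simp), hqt⟩
  obtain ⟨p, hp, hpt⟩ := convexHull_nonempty_iff.1 ⟨q, hinter⟩
  rw [Finset.coe_singleton, Set.mem_singleton_iff] at hp
  exact hp ▸ hpt

theorem isTriangulation : IsTriangulation S K.triangles where
  subset _ ht := K.subset_of_mem_faces ((K.mem_triangles _).1 ht).1
  isTriangle t ht := ⟨((K.mem_triangles t).1 ht).2, K.indep ((K.mem_triangles t).1 ht).1⟩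
  inter_subset t ht t' ht' :=
    K.inter_subset_convexHull ((K.mem_triangles t).1 ht).1 ((K.mem_triangles t').1 ht').1
  mem_of_mem_convexHull t ht _ := K.mem_of_mem_convexHull ((K.mem_triangles t).1 ht).1
  cover x hx hgen := by
    rw [← K.space_eq, Geometry.SimplicialComplex.mem_space_iff] at hx
    obtain ⟨t, ht, hxt⟩ := hx
    refine ⟨t, (K.mem_triangles t).2 ⟨ht, ?_⟩, hxt⟩
    by_contra hcard
    have := card_le_three_of_affineIndependent (K.indep ht)
    exact hgen.notMem_convexHull (K.subset_of_mem_faces ht) (by omega) hxt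

end GeometricTriangulation

theorem IsTriangle.card_inter_le_two {t t' : Finset Plane} (ht : IsTriangle t)
    (ht' : IsTriangle t') (hne : t ≠ t') : (t ∩ t').card ≤ 2 := by
  by_contra! hcard
  have hleft : t ∩ t' = t :=
    Finset.eq_of_subset_of_card_le Finset.inter_subset_left (by rw [ht.1]; omega)
  have hright : t ∩ t' = t' :=
    Finset.eq_of_subset_of_card_le Finset.inter_subset_right (by rw [ht'.1]; omega)
  exact hne (hleft.symm.trans hright)

namespace IsTriangulation

variable {S : Finset Plane} {T T' : Finset (Finset Plane)}

theorem exists_mem_of_isGeneric (hT : IsTriangulation S T) {x y : Plane}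
    (hx : x ∈ convexHull ℝ (S : Set Plane)) (hgen : IsGeneric S x)
    (hy : y ∈ convexHull ℝ (S : Set Plane)) : ∃ t ∈ T, y ∈ convexHull ℝ (t : Set Plane) := by
  have hclosed : IsClosed (⋃ t ∈ T, convexHull ℝ (t : Set Plane)) :=
    T.finite_toSet.isClosed_biUnion fun t _ => (isCompact_convexHull_finset t).isClosed
  have hmem : ∀ᶠ τ in 𝓝[>] (0 : ℝ),
      AffineMap.lineMap y x τ ∈ ⋃ t ∈ T, convexHull ℝ (t : Set Plane) := by
    filter_upwards [hgen.eventually_lineMap y, Ioo_mem_nhdsGT (zero_lt_one (α := ℝ))] with τ hτ h01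
    obtain ⟨t, ht, hxt⟩ := hT.cover _
      ((convex_convexHull ℝ (S : Set Plane)).lineMap_mem hy hx ⟨h01.1.le, h01.2.le⟩) hτ
    exact Set.mem_biUnion ht hxt
  have hlim : Tendsto (fun τ : ℝ => (AffineMap.lineMap y x τ : Plane)) (𝓝[>] 0) (𝓝 y) :=
    tendsto_nhdsWithin_of_tendsto_nhds
      (AffineMap.lineMap_continuous.tendsto' 0 y (AffineMap.lineMap_apply_zero y x))
  simpa using hclosed.mem_of_tendsto hlim hmem

theorem exists_mem (hT : IsTriangulation S T) {t : Finset Plane} (ht : IsTriangle t) (hS : t ⊆ S)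
    {y : Plane} (hy : y ∈ convexHull ℝ (S : Set Plane)) :
    ∃ t ∈ T, y ∈ convexHull ℝ (t : Set Plane) := by
  obtain ⟨x, hx, hgen⟩ := ht.exists_isGeneric S
  exact hT.exists_mem_of_isGeneric (convexHull_mono (Finset.coe_subset.2 hS) hx) hgen hy

theorem eq_of_isGeneric_mem (hT : IsTriangulation S T) {t t' : Finset Plane} (ht : t ∈ T)
    (ht' : t' ∈ T) {x : Plane} (hx : IsGeneric S x) (hxt : x ∈ convexHull ℝ (t : Set Plane))
    (hxt' : x ∈ convexHull ℝ (t' : Set Plane)) : t = t' := by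
  by_contra hne
  have hinter := hT.inter_subset t ht t' ht' ⟨hxt, hxt'⟩
  rw [← Finset.coe_inter] at hinter
  exact hx.notMem_convexHull (Finset.inter_subset_left.trans (hT.subset t ht))
    ((hT.isTriangle t ht).card_inter_le_two (hT.isTriangle t' ht') hne) hinter

theorem area_eq_sum_inter (hT : IsTriangulation S T) {t : Finset Plane} (hS : t ⊆ S) :
    triangleArea t =
      ∑ t' ∈ T, volume.real (convexHull ℝ (t : Set Plane) ∩ convexHull ℝ (t' : Set Plane)) := by
  have hmeas (s : Finset Plane) : MeasurableSet (convexHull ℝ (s : Set Plane)) :=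
    (isCompact_convexHull_finset s).measurableSet
  have hdisjoint : Set.Pairwise (T : Set (Finset Plane)) (Function.onFun (AEDisjoint volume)
      fun t' => convexHull ℝ (t : Set Plane) ∩ convexHull ℝ (t' : Set Plane)) := by
    intro t₁ ht₁ t₂ ht₂ hne
    refine measure_mono_null ?_ (ae_plane_isGeneric S)
    rintro x ⟨⟨-, hx₁⟩, -, hx₂⟩ hgen
    exact hne (hT.eq_of_isGeneric_mem ht₁ ht₂ hgen hx₁ hx₂)
  rw [← measureReal_biUnion_finset₀ hdisjoint
      (fun t' _ => ((hmeas t).inter (hmeas t')).nullMeasurableSet)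
      (fun t' _ => measure_ne_top_of_subset Set.inter_subset_left
        (isCompact_convexHull_finset t).measure_lt_top.ne),
    ← Set.inter_iUnion₂, triangleArea, ← measureReal_def]
  refine measureReal_congr ?_
  filter_upwards [ae_plane_isGeneric S] with x hgen
  refine propext ⟨fun hx => ⟨hx, ?_⟩, And.left⟩
  obtain ⟨t', ht', hxt'⟩ := hT.cover x (convexHull_mono (Finset.coe_subset.2 hS) hx) hgen
  exact Set.mem_biUnion ht' hxt'

/- Both sides are the sum over all pairs of overlapping triangles. -/
theorem sum_mul_area_eq (hT : IsTriangulation S T) (hT' : IsTriangulation S T')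
    (f : Finset Plane → ℝ)
    (h : ∀ t ∈ T, ∀ t' ∈ T', ∀ x, IsGeneric S x → x ∈ convexHull ℝ (t : Set Plane) →
      x ∈ convexHull ℝ (t' : Set Plane) → f t = f t') :
    ∑ t ∈ T, f t * triangleArea t = ∑ t ∈ T', f t * triangleArea t := by
  rw [Finset.sum_congr rfl fun t ht => by rw [hT'.area_eq_sum_inter (hT.subset t ht)],
    Finset.sum_congr (rfl : T' = T') fun t ht => by rw [hT.area_eq_sum_inter (hT'.subset t ht)]]
  simp only [Finset.mul_sum]
  rw [Finset.sum_comm]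
  refine Finset.sum_congr rfl fun t' ht' => Finset.sum_congr rfl fun t ht => ?_
  rw [Set.inter_comm]
  by_cases hx : ∃ x ∈ convexHull ℝ (t' : Set Plane) ∩ convexHull ℝ (t : Set Plane), IsGeneric S x
  · obtain ⟨x, ⟨hxt', hxt⟩, hgen⟩ := hx
    rw [h t ht t' ht' x hgen hxt hxt']
  · push Not at hx
    have hnull : volume.real
        (convexHull ℝ (t' : Set Plane) ∩ convexHull ℝ (t : Set Plane)) = 0 := by
      rw [measureReal_def, measure_mono_null hx (ae_plane_isGeneric S), ENNReal.toReal_zero]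
    rw [hnull, mul_zero, mul_zero]

end IsTriangulation

theorem sphere_power_eq_zero {P : Type*} [MetricSpace P] {s : Sphere P} {p : P} (hp : p ∈ s) :
    s.power p = 0 :=
  (Sphere.power_eq_zero_iff_mem_sphere (Sphere.radius_nonneg_of_mem hp)).2 hp

section Power

variable {E : Type*} [NormedAddCommGroup E] [InnerProductSpace ℝ E]

theorem sphere_power_combination (s : Sphere E) (a b : E) {α β : ℝ} (h : α + β = 1) :
    s.power (α • a + β • b) = α * s.power a + β * s.power b - α * β * dist a b ^ 2 := by
  obtain rfl : α = 1 - β := by linarith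
  simp only [Sphere.power, dist_eq_norm]
  rw [show (1 - β) • a + β • b - s.center = (1 - β) • (a - s.center) + β • (b - s.center) by module,
    ← sub_sub_sub_cancel_right a b s.center, norm_add_sq_real, norm_sub_sq_real (a - s.center)]
  simp only [inner_smul_left, inner_smul_right, norm_smul, mul_pow, Real.norm_eq_abs, sq_abs,
    conj_trivial]
  ring

theorem sum_mul_power_sub_power {ι : Type*} {I : Finset ι} {w : ι → ℝ} {p : ι → E} {x : E}
    (hw : ∑ i ∈ I, w i = 1) (hx : ∑ i ∈ I, w i • p i = x) (s s' : Sphere E) :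
    ∑ i ∈ I, w i * (s.power (p i) - s'.power (p i)) = s.power x - s'.power x := by
  obtain ⟨k, v, haffine⟩ : ∃ (k : ℝ) (v : E), ∀ y, s.power y - s'.power y = k + inner ℝ y v := by
    refine ⟨s.power 0 - s'.power 0, (2 : ℝ) • (s'.center - s.center), fun y => ?_⟩
    simp only [Sphere.power, dist_eq_norm, norm_sub_sq_real, inner_smul_right, inner_sub_right,
      inner_zero_left, norm_zero]
    ring
  simp only [haffine, mul_add, Finset.sum_add_distrib, ← Finset.sum_mul, hw, one_mul,
    ← real_inner_smul_left, ← sum_inner, hx]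

theorem mem_sphere_of_sum_smul_eq {s s' : Sphere E} {t t' : Finset E} {w w' : E → ℝ}
    (hs : 0 ≤ s.radius) (hts : ∀ p ∈ t, p ∈ s) (hts' : ∀ p ∈ t', p ∈ s')
    (hpower : ∀ p ∈ t', 0 ≤ s.power p) (hpower' : ∀ p ∈ t, 0 ≤ s'.power p)
    (hw : ∀ p ∈ t, 0 ≤ w p) (hw' : ∀ p ∈ t', 0 < w' p) (hsum : ∑ p ∈ t, w p = 1)
    (hsum' : ∑ p ∈ t', w' p = 1) (heq : ∑ p ∈ t, w p • p = ∑ p ∈ t', w' p • p) :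
    ∀ p ∈ t', p ∈ s := by
  have hnonpos : ∑ p ∈ t, w p * (s.power p - s'.power p) ≤ 0 := Finset.sum_nonpos fun p hp =>
    mul_nonpos_of_nonneg_of_nonpos (hw p hp)
      (by rw [sphere_power_eq_zero (hts p hp), zero_sub]; exact neg_nonpos.2 (hpower' p hp))
  have hterm (p : E) (hp : p ∈ t') : w' p * (s.power p - s'.power p) = w' p * s.power p := by
    rw [sphere_power_eq_zero (hts' p hp), sub_zero]
  have hzero : ∑ p ∈ t', w' p * s.power p = 0 := by
    refine le_antisymm ?_ (Finset.sum_nonneg fun p hp => mul_nonneg (hw' p hp).le (hpower p hp))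
    rwa [← Finset.sum_congr rfl hterm, sum_mul_power_sub_power hsum' heq.symm,
      ← sum_mul_power_sub_power hsum rfl]
  intro p hp
  have hwp := (Finset.sum_eq_zero_iff_of_nonneg
    fun p hp => mul_nonneg (hw' p hp).le (hpower p hp)).1 hzero p hp
  exact (Sphere.power_eq_zero_iff_mem_sphere hs).1 ((mul_eq_zero.1 hwp).resolve_left (hw' p hp).ne')

end Power

theorem mem_delaunayTriangles {S t : Finset Plane} :
    t ∈ delaunayTriangles S ↔ t ⊆ S ∧ IsTriangle t ∧
      ∃ s : Sphere Plane, (∀ p ∈ t, p ∈ s) ∧ ∀ q ∈ S, 0 ≤ s.power q := by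
  simp only [delaunayTriangles, Finset.mem_filter, Finset.mem_powersetCard, and_assoc]
  rw [← and_assoc (a := t.card = 3), ← IsTriangle]
  refine and_congr_right fun _ => and_congr_right fun ht => ?_
  obtain ⟨p₀, hp₀⟩ := ht.nonempty
  constructor
  · rintro ⟨c, r, hc, hr⟩
    exact ⟨⟨c, r⟩, hc, fun q hq => (Sphere.power_nonneg_iff_radius_le_dist_center
      (hc p₀ hp₀ ▸ dist_nonneg)).2 (hr q hq)⟩
  · rintro ⟨s, hts, hs⟩
    exact ⟨s.center, s.radius, hts, fun q hq => (Sphere.power_nonneg_iff_radius_le_dist_center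
      (Sphere.radius_nonneg_of_mem (hts p₀ hp₀))).1 (hs q hq)⟩

theorem exists_sphere_of_common_point {S t t' : Finset Plane} (ht : t ∈ delaunayTriangles S)
    (ht' : t' ∈ delaunayTriangles S) {x : Plane} (hgen : IsGeneric S x)
    (hx : x ∈ convexHull ℝ (t : Set Plane)) (hx' : x ∈ convexHull ℝ (t' : Set Plane)) :
    ∃ s : Sphere Plane, ∀ p ∈ t ∪ t', p ∈ s := by
  obtain ⟨hS, h3, s, hts, hs⟩ := mem_delaunayTriangles.1 ht
  obtain ⟨hS', h3', s', hts', hs'⟩ := mem_delaunayTriangles.1 ht'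
  obtain ⟨w, hw, hsum, hwx⟩ := hgen.exists_pos_weights hS h3.1.le hx
  obtain ⟨w', hw', hsum', hwx'⟩ := hgen.exists_pos_weights hS' h3'.1.le hx'
  obtain ⟨p₀, hp₀⟩ := h3.nonempty
  have hmem := mem_sphere_of_sum_smul_eq (Sphere.radius_nonneg_of_mem (hts p₀ hp₀)) hts hts'
    (fun p hp => hs p (hS' hp)) (fun p hp => hs' p (hS hp)) (fun p hp => (hw p hp).le) hw' hsum
    hsum' (hwx.trans hwx'.symm)
  exact ⟨s, fun p hp => (Finset.mem_union.1 hp).elim (hts p) (hmem p)⟩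

namespace IsTriangulation

variable {S : Finset Plane} {T T' : Finset (Finset Plane)}

theorem sum_radiusWeight_eq_of_delaunay (hT : IsTriangulation S T) (hT' : IsTriangulation S T')
    (hD : T ⊆ delaunayTriangles S) (hD' : T' ⊆ delaunayTriangles S) (α : ℝ) :
    ∑ t ∈ T, radiusWeight α t = ∑ t ∈ T', radiusWeight α t := by
  refine hT.sum_mul_area_eq hT' (fun t => triangleCircumradius t ^ α)
    fun t ht t' ht' x hgen hx hx' => ?_
  obtain ⟨s, hs⟩ := exists_sphere_of_common_point (hD ht) (hD' ht') hgen hx hx'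
  rw [(hT.isTriangle t ht).circumradius_eq fun p hp => hs p (Finset.mem_union_left _ hp),
    (hT'.isTriangle t' ht').circumradius_eq fun p hp => hs p (Finset.mem_union_right _ hp)]

theorem eq_delaunayTriangles (hT : IsTriangulation S T) (hS : NoFourCocircular S)
    (hD : T ⊆ delaunayTriangles S) : T = delaunayTriangles S := by
  refine hD.antisymm fun t ht => ?_
  obtain ⟨htS, h3, -⟩ := mem_delaunayTriangles.1 ht
  obtain ⟨x, hx, hgen⟩ := h3.exists_isGeneric S
  obtain ⟨t', ht', hx'⟩ := hT.cover x (convexHull_mono (Finset.coe_subset.2 htS) hx) hgen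
  obtain ⟨s, hs⟩ := exists_sphere_of_common_point ht (hD ht') hgen hx hx'
  have hcard := hS s.center s.radius (t ∪ t') (Finset.union_subset htS (hT.subset t' ht')) hs
  have ht_union : t = t ∪ t' :=
    Finset.eq_of_subset_of_card_le Finset.subset_union_left (by rwa [h3.1])
  have ht'_union : t' = t ∪ t' :=
    Finset.eq_of_subset_of_card_le Finset.subset_union_right
      (by rwa [(hT.isTriangle t' ht').1])
  rwa [ht_union, ← ht'_union]

end IsTriangulation

theorem exists_last_lineMap_mem {E : Type*} [NormedAddCommGroup E] [NormedSpace ℝ E] {A : Set E}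
    (hA : IsClosed A) {x q : E} (hx : x ∈ A) (hq : q ∉ A) :
    ∃ τ ∈ Set.Ico (0 : ℝ) 1, AffineMap.lineMap x q τ ∈ A ∧
      ∀ ε ∈ Set.Ioc (0 : ℝ) 1, AffineMap.lineMap (AffineMap.lineMap x q τ) q ε ∉ A := by
  have hcompact : IsCompact (Set.Icc (0 : ℝ) 1 ∩ AffineMap.lineMap x q ⁻¹' A) :=
    isCompact_Icc.inter_right (hA.preimage AffineMap.lineMap_continuous)
  obtain ⟨τ, ⟨⟨hτ_nonneg, hτ_le⟩, hτA⟩, hτ_max⟩ :=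
    hcompact.exists_isGreatest ⟨0, by simpa using hx⟩
  have hτ_lt : τ < 1 := hτ_le.lt_of_ne <| by
    rintro rfl
    exact hq (by simpa using hτA)
  refine ⟨τ, ⟨hτ_nonneg, hτ_lt⟩, hτA, fun ε hε hmem => ?_⟩
  rw [AffineMap.lineMap_lineMap_left] at hmem
  have hlt : τ < 1 - (1 - ε) * (1 - τ) := by nlinarith [hε.1]
  exact hlt.not_ge (hτ_max ⟨⟨by linarith, by nlinarith [hε.2]⟩, hmem⟩)

theorem IsGeneric.lineMap_notMem {E : Type*} [NormedAddCommGroup E] [NormedSpace ℝ E]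
    {S : Finset E} {x q : E} (hx : IsGeneric S x) (hq : q ∈ S) {τ : ℝ} (hτ : τ < 1) :
    AffineMap.lineMap x q τ ∉ S := by
  intro hmem
  have hline : AffineMap.lineMap (AffineMap.lineMap x q τ) q (1 - (1 - τ)⁻¹) = x := by
    rw [AffineMap.lineMap_lineMap_left, sub_sub_cancel, inv_mul_cancel₀ (by linarith), sub_self,
      AffineMap.lineMap_apply_zero]
  have hx_mem := AffineMap.lineMap_mem_affineSpan_pair (1 - (1 - τ)⁻¹) (AffineMap.lineMap x q τ) q
  rw [hline] at hx_mem
  exact hx _ hmem q hq hx_mem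

theorem eventually_orient_nonneg {u v y q : Plane} (hy : 0 ≤ orient u v y)
    (hq : orient u v y = 0 → 0 ≤ orient u v q) :
    ∀ᶠ ε in 𝓝[>] (0 : ℝ), 0 ≤ orient u v (AffineMap.lineMap y q ε) := by
  simp only [orient_lineMap]
  rcases hy.eq_or_lt with hy | hy
  · filter_upwards [self_mem_nhdsWithin] with ε hε
    rw [← hy, mul_zero, zero_add]
    exact mul_nonneg (le_of_lt hε) (hq hy.symm)
  · have hcont : ContinuousAt (fun ε : ℝ => (1 - ε) * orient u v y + ε * orient u v q) 0 := by
      fun_prop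
    filter_upwards [nhdsWithin_le_nhds (hcont.eventually (lt_mem_nhds (a := 0) (by simpa)))]
      with ε hε using hε.le

theorem IsTriangle.exists_exit_edge {t : Finset Plane} (ht : IsTriangle t) {y q : Plane}
    (hy : y ∈ convexHull ℝ (t : Set Plane))
    (hexit : ¬ ∀ᶠ ε in 𝓝[>] (0 : ℝ), AffineMap.lineMap y q ε ∈ convexHull ℝ (t : Set Plane)) :
    ∃ a b c : Plane, t = {a, b, c} ∧ 0 < orient a b c ∧ orient a b y = 0 ∧ orient a b q < 0 := by
  obtain ⟨a, b, c, rfl, h⟩ := ht.exists_orient_pos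
  by_contra! hstay
  apply hexit
  simp only [Finset.coe_insert, Finset.coe_singleton, mem_convexHull_triple_iff_orient h] at hy ⊢
  obtain ⟨hbc, hca, hab⟩ := hy
  rw [← orient_rotate] at hbc
  rw [← orient_rotate, ← orient_rotate] at hca
  filter_upwards [
    eventually_orient_nonneg hbc (hstay b c a (by grind) (by rwa [orient_rotate])),
    eventually_orient_nonneg hca (hstay c a b (by grind) (by rwa [← orient_rotate])),
    eventually_orient_nonneg hab (hstay a b c rfl h)] with ε hbc' hca' hab'
  exact ⟨by rwa [← orient_rotate], by rwa [← orient_rotate, ← orient_rotate], hab'⟩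

theorem eq_of_mem_segment_of_orient_eq_zero {a b c p y : Plane} (hc : orient a b c ≠ 0)
    (hp : orient a b p = 0) (hy : y ∈ segment ℝ p c) (hy0 : orient a b y = 0) : y = p := by
  rw [segment_eq_image_lineMap] at hy
  obtain ⟨τ, -, rfl⟩ := hy
  rw [orient_lineMap, hp, mul_zero, zero_add] at hy0
  rw [(mul_eq_zero.1 hy0).resolve_right hc, AffineMap.lineMap_apply_zero]

namespace IsTriangulation

variable {S : Finset Plane} {T : Finset (Finset Plane)}

theorem exists_frequently_mem (hT : IsTriangulation S T) {t : Finset Plane} (ht : t ∈ T)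
    {y q : Plane} (hy : y ∈ convexHull ℝ (S : Set Plane)) (hq : q ∈ convexHull ℝ (S : Set Plane)) :
    ∃ t' ∈ T, y ∈ convexHull ℝ (t' : Set Plane) ∧
      ∃ᶠ ε in 𝓝[>] (0 : ℝ), AffineMap.lineMap y q ε ∈ convexHull ℝ (t' : Set Plane) := by
  obtain ⟨t', ht', hfreq⟩ : ∃ t' ∈ T, ∃ᶠ ε in 𝓝[>] (0 : ℝ),
      AffineMap.lineMap y q ε ∈ convexHull ℝ (t' : Set Plane) := by
    by_contra! h
    rw [← Finset.eventually_all] at h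
    obtain ⟨ε, hε, hε_pos, hε_lt⟩ := (h.and (Ioo_mem_nhdsGT zero_lt_one)).exists
    obtain ⟨t', ht', hmem⟩ := hT.exists_mem (hT.isTriangle t ht) (hT.subset t ht)
      ((convex_convexHull ℝ (S : Set Plane)).lineMap_mem hy hq ⟨hε_pos.le, hε_lt.le⟩)
    exact hε t' ht' hmem
  refine ⟨t', ht',
    (isCompact_convexHull_finset t').isClosed.mem_of_frequently_of_tendsto hfreq ?_, hfreq⟩
  have hlim := (AffineMap.lineMap_continuous (R := ℝ) (p := y) (q := q)).tendsto 0
  rw [AffineMap.lineMap_apply_zero] at hlim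
  exact hlim.mono_left nhdsWithin_le_nhds

theorem exists_eq_of_mem_edge (hT : IsTriangulation S T) {a b c y : Plane} {t' : Finset Plane}
    (ht : {a, b, c} ∈ T) (ht' : t' ∈ T) (habc : orient a b c ≠ 0) (hyS : y ∉ S)
    (hy0 : orient a b y = 0)
    (hy : y ∈ convexHull ℝ (({a, b, c} : Finset Plane) : Set Plane))
    (hy' : y ∈ convexHull ℝ (t' : Set Plane)) : ∃ d, t' = {a, b, d} := by
  have hmem {p p' : Plane} (hp : {p, p', c} = ({a, b, c} : Finset Plane))
      (hp0 : orient a b p = 0) : p' ∈ t' := by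
    by_contra hp'
    have hinter := hT.inter_subset _ ht t' ht' ⟨hy, hy'⟩
    have hsubset : (({a, b, c} : Finset Plane) : Set Plane) ∩ t' ⊆ {p, c} := by
      rintro z ⟨hz, hzt'⟩
      rw [← hp] at hz
      simp only [Finset.coe_insert, Finset.coe_singleton, Set.mem_insert_iff,
        Set.mem_singleton_iff] at hz ⊢
      exact hz.imp_right (Or.resolve_left · (by rintro rfl; exact hp' hzt'))
    have hsegment := convexHull_mono hsubset hinter
    rw [convexHull_pair] at hsegment
    exact hyS (eq_of_mem_segment_of_orient_eq_zero habc hp0 hsegment hy0 ▸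
      hT.subset _ ht (by simp [← hp]))
  have hb : b ∈ t' := hmem rfl (orient_self_mid a b)
  have ha : a ∈ t' := hmem (Finset.insert_comm b a {c}) (orient_self_right a b)
  exact exists_eq_triple_of_mem (ne_of_orient_ne_zero habc).1 ha hb (hT.isTriangle t' ht').1

theorem exists_adjacent_triangles (hT : IsTriangulation S T) {T₀ : Finset (Finset Plane)}
    (hT₀ : T₀ ⊆ T) (hne : T₀.Nonempty) {q : Plane} (hq : q ∈ S)
    (hqT₀ : ∀ t ∈ T₀, q ∉ convexHull ℝ (t : Set Plane)) :
    ∃ a b c d : Plane, {a, b, c} ∈ T₀ ∧ {a, b, d} ∈ T ∧ {a, b, d} ∉ T₀ ∧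
      0 < orient a b c ∧ orient a b d < 0 ∧ orient a b q < 0 := by
  obtain ⟨t₀, ht₀⟩ := hne
  obtain ⟨x, hx, hgen⟩ := (hT.isTriangle t₀ (hT₀ ht₀)).exists_isGeneric S
  have hclosed : IsClosed (⋃ t ∈ T₀, convexHull ℝ (t : Set Plane)) :=
    T₀.finite_toSet.isClosed_biUnion fun t _ => (isCompact_convexHull_finset t).isClosed
  obtain ⟨τ, hτ, hyT₀, hleave⟩ :=
    exists_last_lineMap_mem hclosed (Set.mem_biUnion ht₀ hx) (q := q) (by simpa using hqT₀)
  have hyS := hgen.lineMap_notMem hq hτ.2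
  set y := AffineMap.lineMap x q τ
  obtain ⟨t, ht, hyt⟩ := Set.mem_iUnion₂.1 hyT₀
  have hleave' (t') (ht' : t' ∈ T₀) : ∀ᶠ ε in 𝓝[>] (0 : ℝ),
      AffineMap.lineMap y q ε ∉ convexHull ℝ (t' : Set Plane) := by
    filter_upwards [Ioc_mem_nhdsGT zero_lt_one] with ε hε hmem
    exact hleave ε hε (Set.mem_biUnion ht' hmem)
  obtain ⟨a, b, c, rfl, hc, hy0, hq0⟩ :=
    (hT.isTriangle t (hT₀ ht)).exists_exit_edge hyt fun h =>
      ((hleave' t ht).and h).exists.elim fun ε hε => hε.1 hε.2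
  obtain ⟨t', ht', hyt', hfreq⟩ := hT.exists_frequently_mem (hT₀ ht)
    (convexHull_mono (Finset.coe_subset.2 (hT.subset _ (hT₀ ht))) hyt)
    (subset_convexHull ℝ _ hq)
  obtain ⟨d, rfl⟩ := hT.exists_eq_of_mem_edge (hT₀ ht) ht' hc.ne' hyS hy0 hyt hyt'
  refine ⟨a, b, c, d, ht, ht', fun hmem => hfreq (hleave' _ hmem), hc, ?_, hq0⟩
  obtain ⟨ε, hε, hε_pos⟩ := (hfreq.and_eventually self_mem_nhdsWithin).exists
  rw [Finset.coe_insert, Finset.coe_insert, Finset.coe_singleton] at hε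
  obtain ⟨w, hw, horient⟩ := exists_orient_eq_mul_of_mem_convexHull hε
  rw [orient_lineMap, hy0, mul_zero, zero_add] at horient
  exact neg_of_mul_neg_right (horient ▸ mul_neg_of_pos_of_neg hε_pos hq0) hw

end IsTriangulation

theorem exists_diagonals_cross {a b c d : Plane} (hc : 0 < orient a b c) (hd : orient a b d < 0) :
    ∃ α β γ δ : ℝ, 0 < γ ∧ 0 < δ ∧ α + β = 1 ∧ γ + δ = 1 ∧
      α • a + β • b = γ • c + δ • d := by
  have hpos : 0 < orient a b c - orient a b d := by linarith
  set δ := orient a b c / (orient a b c - orient a b d) with hδ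
  have hδ_lt : δ < 1 := (div_lt_one hpos).2 (by linarith)
  have hzero : orient a b (AffineMap.lineMap c d δ) = 0 := by
    rw [orient_lineMap, hδ]
    field_simp
    ring
  obtain ⟨β, hβ⟩ := exists_lineMap_eq_of_orient_eq_zero (ne_of_orient_ne_zero hc.ne').1 hzero
  rw [AffineMap.lineMap_apply_module, AffineMap.lineMap_apply_module] at hβ
  exact ⟨1 - β, β, 1 - δ, δ, sub_pos.2 hδ_lt, div_pos hc hpos, by ring, by ring, hβ⟩

theorem exists_flippableQuad {a b c d : Plane} {s : Sphere Plane} (hc : 0 < orient a b c)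
    (hd : orient a b d < 0) (has : a ∈ s) (hbs : b ∈ s) (hcs : c ∈ s) (hds : s.power d < 0) :
    ∃ α β γ δ : ℝ, FlippableQuad a b c d α β γ δ := by
  obtain ⟨α, β, γ, δ, hγ, hδ, hαβ, hγδ, hcross⟩ := exists_diagonals_cross hc hd
  have hpower : γ * δ * dist c d ^ 2 < α * β * dist a b ^ 2 := by
    have heq := sphere_power_combination s a b hαβ
    rw [hcross, sphere_power_combination s c d hγδ, sphere_power_eq_zero has,
      sphere_power_eq_zero hbs, sphere_power_eq_zero hcs] at heq
    linarith [mul_neg_of_pos_of_neg hδ hds]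
  have hαβ_pos : 0 < α * β :=
    pos_of_mul_pos_left (lt_of_le_of_lt (by positivity) hpower) (sq_nonneg _)
  obtain ⟨hα, hβ⟩ : 0 < α ∧ 0 < β :=
    (mul_pos_iff.1 hαβ_pos).resolve_right fun h => by linarith [h.1, h.2]
  exact ⟨α, β, γ, δ, hα, hβ, hγ, hδ, hαβ, hγδ, hcross, hc, hpower⟩

theorem power_neg_of_power_lt {a b d q : Plane} {s s' : Sphere Plane} (hd : orient a b d < 0)
    (hq : orient a b q < 0) (has : a ∈ s) (hbs : b ∈ s) (has' : a ∈ s') (hbs' : b ∈ s')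
    (hds' : d ∈ s') (h : s.power q < s'.power q) : s.power d < 0 := by
  have hsum : orient q b d / orient a b d + orient a q d / orient a b d +
      orient a b q / orient a b d = 1 := by
    rw [← add_div, ← add_div, orient_add, div_self hd.ne]
  have heq := sum_mul_power_sub_power (I := Finset.univ) (p := ![a, b, d])
    (w := ![orient q b d / orient a b d, orient a q d / orient a b d, orient a b q / orient a b d])
    (by simpa [Fin.sum_univ_three] using hsum)
    (by simpa [Fin.sum_univ_three] using orient_combination_eq q hd.ne) s' s
  simp only [Fin.sum_univ_three, Matrix.cons_val_zero, Matrix.cons_val_one, Matrix.cons_val,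
    sphere_power_eq_zero has, sphere_power_eq_zero hbs, sphere_power_eq_zero has',
    sphere_power_eq_zero hbs', sphere_power_eq_zero hds'] at heq
  have hprod : orient a b q / orient a b d * s.power d < 0 := by linarith
  exact neg_of_mul_neg_right hprod (div_pos_of_neg_of_neg hq hd).le

namespace IsTriangulation

variable {S : Finset Plane} {T : Finset (Finset Plane)}

theorem exists_flippableQuad_of_not_delaunay (hT : IsTriangulation S T)
    (hnd : ¬ T ⊆ delaunayTriangles S) :
    ∃ (a b c d : Plane) (α β γ δ : ℝ), FlippableQuad a b c d α β γ δ ∧ {a, b, c} ∈ T ∧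
      {a, b, d} ∈ T := by
  have hcircle (t) (ht : t ∈ T) : ∃ s : Sphere Plane, ∀ p ∈ t, p ∈ s := by
    obtain ⟨o, ho⟩ := (hT.isTriangle t ht).exists_circumcircle
    exact ⟨⟨o, _⟩, ho⟩
  choose! s hs using hcircle
  obtain ⟨t₀, ht₀, hbad⟩ := Finset.not_subset.1 hnd
  obtain ⟨q, hqS, hq⟩ : ∃ q ∈ S, (s t₀).power q < 0 := by
    by_contra! h
    exact hbad (mem_delaunayTriangles.2
      ⟨hT.subset t₀ ht₀, hT.isTriangle t₀ ht₀, s t₀, hs t₀ ht₀, h⟩)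
  obtain ⟨t₁, ht₁, hmin⟩ := T.exists_min_image (fun t => (s t).power q) ⟨t₀, ht₀⟩
  have hmem {t} : t ∈ {t ∈ T | (s t).power q = (s t₁).power q} ↔
      t ∈ T ∧ (s t).power q = (s t₁).power q := Finset.mem_filter
  obtain ⟨a, b, c, d, habc, habd, habd', hc, hd, hq0⟩ :=
    hT.exists_adjacent_triangles (Finset.filter_subset _ T) ⟨t₁, hmem.2 ⟨ht₁, rfl⟩⟩ hqS
      fun t ht hqt => by
        have hqs := hs t (hmem.1 ht).1 q (hT.mem_of_mem_convexHull t (hmem.1 ht).1 q hqS hqt)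
        linarith [hmin t₀ ht₀, (hmem.1 ht).2, sphere_power_eq_zero hqs]
  obtain ⟨habcT, hpower⟩ := hmem.1 habc
  have hlt : (s {a, b, c}).power q < (s {a, b, d}).power q :=
    hpower.trans_lt ((hmin _ habd).lt_of_ne' fun h => habd' (hmem.2 ⟨habd, h⟩))
  have hds := power_neg_of_power_lt hd hq0 (hs _ habcT a (by simp)) (hs _ habcT b (by simp))
    (hs _ habd a (by simp)) (hs _ habd b (by simp)) (hs _ habd d (by simp)) hlt
  obtain ⟨α, β, γ, δ, hquad⟩ := exists_flippableQuad hc hd (hs _ habcT a (by simp))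
    (hs _ habcT b (by simp)) (hs _ habcT c (by simp)) hds
  exact ⟨a, b, c, d, α, β, γ, δ, hquad, habcT, habd⟩

end IsTriangulation

theorem IsTriangle.orient_ne_zero {a b c : Plane} (h : IsTriangle {a, b, c}) :
    orient a b c ≠ 0 := by
  obtain ⟨hab, hac, hbc⟩ := Finset.card_triple_eq_three_iff.1 h.1
  exact (affineIndependent_triple_iff hab hac hbc).1 h.2

section Convex

variable {E : Type*} [AddCommGroup E] [Module ℝ E]

theorem mem_convexHull_of_convexOn_nonpos {f : E → ℝ} (hf : ConvexOn ℝ Set.univ f) {A : Set E}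
    (hA : ∀ p ∈ A, f p ≤ 0) {x : E} (hx : x ∈ convexHull ℝ A) (hfx : 0 ≤ f x) :
    x ∈ convexHull ℝ {p ∈ A | f p = 0} := by
  set B := convexHull ℝ {p ∈ A | f p = 0}
  have hB (y) (hy : y ∈ B) : f y ≤ 0 :=
    (convexHull_min (t := {y ∈ Set.univ | f y ≤ 0}) (fun p hp => ⟨Set.mem_univ p, hp.2.le⟩)
      (hf.convex_le 0) hy).2
  have hconvex : Convex ℝ ({y | f y < 0} ∪ B) := by
    intro y hy z hz u v hu hv huv
    rcases hu.eq_or_lt with rfl | hu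
    · simpa [show v = 1 by linarith] using hz
    rcases hv.eq_or_lt with rfl | hv
    · simpa [show u = 1 by linarith] using hy
    have hle : f (u • y + v • z) ≤ u * f y + v * f z :=
      hf.2 (Set.mem_univ y) (Set.mem_univ z) hu.le hv.le huv
    rcases hy with hy | hy <;> rcases hz with hz | hz
    · exact Or.inl (hle.trans_lt (add_neg (mul_neg_of_pos_of_neg hu hy)
        (mul_neg_of_pos_of_neg hv hz)))
    · exact Or.inl (hle.trans_lt (add_neg_of_neg_of_nonpos (mul_neg_of_pos_of_neg hu hy)
        (mul_nonpos_of_nonneg_of_nonpos hv.le (hB z hz))))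
    · exact Or.inl (hle.trans_lt (add_neg_of_nonpos_of_neg
        (mul_nonpos_of_nonneg_of_nonpos hu.le (hB y hy)) (mul_neg_of_pos_of_neg hv hz)))
    · exact Or.inr (convex_convexHull ℝ _ hy hz hu.le hv.le huv)
  have hsubset : A ⊆ {y | f y < 0} ∪ B := fun p hp =>
    (hA p hp).lt_or_eq.imp_right fun h => subset_convexHull ℝ _ ⟨hp, h⟩
  exact (convexHull_min hsubset hconvex hx).resolve_left hfx.not_gt

theorem mem_convexHull_of_diagonals_cross {a b c d x : E} {α β γ δ : ℝ} (hα : 0 < α) (hβ : 0 < β)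
    (hγ : 0 ≤ γ) (hδ : 0 ≤ δ) (hαβ : α + β = 1) (hγδ : γ + δ = 1)
    (hcross : α • a + β • b = γ • c + δ • d) (hx : x ∈ convexHull ℝ ({a, b, c} : Set E)) :
    x ∈ convexHull ℝ ({c, d, a} : Set E) ∨ x ∈ convexHull ℝ ({c, d, b} : Set E) := by
  obtain ⟨u, v, w, hu, hv, hw, hsum, rfl⟩ := mem_convexHull_triple.1 hx
  rcases le_total (v * α) (u * β) with hle | hle
  · refine Or.inl (mem_convexHull_triple.2
      ⟨w + v / β * γ, v / β * δ, u - v / β * α, by positivity, by positivity, ?_, ?_, ?_⟩)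
    · rw [sub_nonneg, div_mul_eq_mul_div, div_le_iff₀ hβ]
      exact hle
    · have hcancel : v / β * β = v := div_mul_cancel₀ v hβ.ne'
      linear_combination hsum + v / β * hγδ - v / β * hαβ + hcancel
    · have hb : v • b = (v / β) • β • b := by rw [smul_smul, div_mul_cancel₀ v hβ.ne']
      rw [hb, eq_sub_of_add_eq' hcross]
      module
  · refine Or.inr (mem_convexHull_triple.2
      ⟨w + u / α * γ, u / α * δ, v - u / α * β, by positivity, by positivity, ?_, ?_, ?_⟩)
    · rw [sub_nonneg, div_mul_eq_mul_div, div_le_iff₀ hα]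
      exact hle
    · have hcancel : u / α * α = u := div_mul_cancel₀ u hα.ne'
      linear_combination hsum + u / α * hγδ - u / α * hαβ + hcancel
    · have ha : u • a = (u / α) • α • a := by rw [smul_smul, div_mul_cancel₀ u hα.ne']
      rw [ha, eq_sub_of_add_eq hcross]
      module

end Convex

theorem convexOn_orient (a b : Plane) : ConvexOn ℝ Set.univ (orient a b) := by
  refine ⟨convex_univ, fun x _ y _ u v _ _ huv => le_of_eq ?_⟩
  obtain rfl : u = 1 - v := by linarith
  rw [← AffineMap.lineMap_apply_module, orient_lineMap, smul_eq_mul, smul_eq_mul]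

theorem exists_mem_convexHull_inter_of_orient_pos {a b c e : Plane} (hc : 0 < orient a b c)
    (he : 0 < orient a b e) :
    ∃ x ∈ convexHull ℝ ({a, b, c} : Set Plane) ∩ convexHull ℝ {a, b, e}, 0 < orient a b x := by
  set z := AffineMap.lineMap a b (1 / 2 : ℝ)
  have hbe : 0 < orient b e z := by
    rw [orient_lineMap, orient_rotate, orient_self_mid]
    linarith
  have hea : 0 < orient e a z := by
    rw [orient_lineMap, orient_self_right, ← orient_rotate e a b]
    linarith
  have hab : orient a b z = 0 := by rw [orient_lineMap, orient_self_mid, orient_self_right]; ring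
  obtain ⟨ε, ⟨hbe', hea'⟩, hε_pos, hε_lt⟩ :=
    (((eventually_orient_nonneg hbe.le fun h => absurd h hbe.ne').and
      (eventually_orient_nonneg hea.le fun h => absurd h hea.ne')).and
      (Ioo_mem_nhdsGT (zero_lt_one (α := ℝ)))).exists
  have hpos : 0 < orient a b (AffineMap.lineMap z c ε) := by
    rw [orient_lineMap, hab, mul_zero, zero_add]
    exact mul_pos hε_pos hc
  refine ⟨AffineMap.lineMap z c ε, ⟨?_, ?_⟩, hpos⟩
  · refine (convex_convexHull ℝ _).lineMap_mem ?_ (subset_convexHull ℝ _ (by simp))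
      ⟨hε_pos.le, hε_lt.le⟩
    exact (convex_convexHull ℝ _).lineMap_mem (subset_convexHull ℝ _ (by simp))
      (subset_convexHull ℝ _ (by simp)) (by norm_num)
  · rw [mem_convexHull_triple_iff_orient he]
    exact ⟨by rwa [← orient_rotate], by rwa [← orient_rotate, ← orient_rotate], hpos.le⟩

namespace IsTriangulation

variable {S : Finset Plane} {T : Finset (Finset Plane)} {a b c d e : Plane}

theorem eq_of_orient_pos (hT : IsTriangulation S T) (hc : {a, b, c} ∈ T) (he : {a, b, e} ∈ T)
    (hc_pos : 0 < orient a b c) (he_pos : 0 < orient a b e) : e = c := by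
  by_contra hne
  obtain ⟨x, hx, hpos⟩ := exists_mem_convexHull_inter_of_orient_pos hc_pos he_pos
  have hinter := hT.inter_subset _ hc _ he (by simpa using hx)
  have hsubset : (({a, b, c} : Finset Plane) : Set Plane) ∩ ({a, b, e} : Finset Plane) ⊆
      {p | orient a b p ≤ 0} := by
    rintro p ⟨hp, hp'⟩
    simp only [Finset.coe_insert, Finset.coe_singleton, Set.mem_insert_iff,
      Set.mem_singleton_iff] at hp hp'
    grind [orient_self_mid, orient_self_right]
  have hle := convexHull_min hsubset
    (by simpa using (convexOn_orient a b).convex_le 0) hinter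
  exact hpos.not_ge hle

theorem eq_or_eq_of_mem_edge (hT : IsTriangulation S T) (hc : {a, b, c} ∈ T) (hd : {a, b, d} ∈ T)
    (hc_pos : 0 < orient a b c) (hd_neg : orient a b d < 0) {r : Finset Plane} (hr : r ∈ T)
    (har : a ∈ r) (hbr : b ∈ r) : r = {a, b, c} ∨ r = {a, b, d} := by
  obtain ⟨e, rfl⟩ := exists_eq_triple_of_mem (ne_of_orient_ne_zero hc_pos.ne').1 har hbr
    (hT.isTriangle r hr).1
  rcases lt_or_gt_of_ne (hT.isTriangle _ hr).orient_ne_zero with he | he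
  · rw [Finset.insert_comm] at hd hr
    rw [← neg_pos, ← orient_swap] at he hd_neg
    exact Or.inr (by rw [hT.eq_of_orient_pos hd hr hd_neg he])
  · exact Or.inl (by rw [hT.eq_of_orient_pos hc hr hc_pos he])

end IsTriangulation

theorem convexHull_union_subset_of_diagonals_cross {E : Type*} [AddCommGroup E] [Module ℝ E]
    {a b c d : E} {α β γ δ : ℝ} (hα : 0 < α) (hβ : 0 < β) (hγ : 0 ≤ γ) (hδ : 0 ≤ δ)
    (hαβ : α + β = 1) (hγδ : γ + δ = 1) (hcross : α • a + β • b = γ • c + δ • d) :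
    convexHull ℝ ({a, b, c} : Set E) ∪ convexHull ℝ {a, b, d} ⊆
      convexHull ℝ {c, d, a} ∪ convexHull ℝ {c, d, b} := by
  refine Set.union_subset
    (fun x => mem_convexHull_of_diagonals_cross hα hβ hγ hδ hαβ hγδ hcross) fun x hx => ?_
  rw [Set.insert_comm c d, Set.insert_comm c d]
  exact mem_convexHull_of_diagonals_cross hα hβ hδ hγ hαβ ((add_comm δ γ).trans hγδ)
    (hcross.trans (add_comm _ _)) hx

namespace FlippableQuad

variable {a b c d : Plane} {α β γ δ : ℝ}

theorem symm (h : FlippableQuad a b c d α β γ δ) : FlippableQuad b a d c β α δ γ where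
  α_pos := h.β_pos
  β_pos := h.α_pos
  γ_pos := h.δ_pos
  δ_pos := h.γ_pos
  α_add_β := (add_comm β α).trans h.α_add_β
  γ_add_δ := (add_comm δ γ).trans h.γ_add_δ
  cross := by rw [add_comm, h.cross, add_comm]
  orient_pos := by
    obtain ⟨X, hX, -, habd, -⟩ := h.exists_orient_eq
    rw [orient_swap, habd, neg_neg]
    exact mul_pos h.γ_pos hX
  power_lt := by
    rw [dist_comm d, dist_comm b, mul_comm δ, mul_comm β]
    exact h.power_lt

theorem orient_left_neg (h : FlippableQuad a b c d α β γ δ) : orient c d a < 0 := by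
  obtain ⟨X, hX, -, -, hcda, -⟩ := h.exists_orient_eq
  rw [hcda, neg_lt_zero]
  exact mul_pos h.β_pos hX

theorem orient_right_pos (h : FlippableQuad a b c d α β γ δ) : 0 < orient c d b := by
  rw [orient_swap, neg_pos]
  exact h.symm.orient_left_neg

theorem orient_nonpos_of_mem_convexHull (h : FlippableQuad a b c d α β γ δ) {x : Plane}
    (hx : x ∈ convexHull ℝ ({c, d, a} : Set Plane)) : orient c d x ≤ 0 := by
  obtain ⟨w, hw, hwx⟩ := exists_orient_eq_mul_of_mem_convexHull hx
  exact hwx ▸ mul_nonpos_of_nonneg_of_nonpos hw h.orient_left_neg.le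

theorem convexHull_union (h : FlippableQuad a b c d α β γ δ) :
    convexHull ℝ ({a, b, c} : Set Plane) ∪ convexHull ℝ {a, b, d} =
      convexHull ℝ {c, d, a} ∪ convexHull ℝ {c, d, b} :=
  (convexHull_union_subset_of_diagonals_cross h.α_pos h.β_pos h.γ_pos.le h.δ_pos.le h.α_add_β
    h.γ_add_δ h.cross).antisymm
  (convexHull_union_subset_of_diagonals_cross h.γ_pos h.δ_pos h.α_pos.le h.β_pos.le h.γ_add_δ
    h.α_add_β h.cross.symm)

theorem convexHull_inter_subset (h : FlippableQuad a b c d α β γ δ) :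
    convexHull ℝ ({c, d, a} : Set Plane) ∩ convexHull ℝ {c, d, b} ⊆
      convexHull ℝ ({c, d, a} ∩ {c, d, b}) := by
  rintro x ⟨hxa, hxb⟩
  obtain ⟨w, hw, hwx⟩ := exists_orient_eq_mul_of_mem_convexHull hxb
  have hedge := mem_convexHull_of_convexOn_nonpos (convexOn_orient c d)
    (fun p hp => h.orient_nonpos_of_mem_convexHull (subset_convexHull ℝ _ hp)) hxa
    (hwx ▸ mul_nonneg hw h.orient_right_pos.le)
  refine convexHull_mono ?_ hedge
  rintro p ⟨hp, hp0⟩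
  have hpa : p ≠ a := fun heq => h.orient_left_neg.ne (heq ▸ hp0)
  simp only [Set.mem_inter_iff, Set.mem_insert_iff, Set.mem_singleton_iff] at hp ⊢
  tauto

theorem ne_triangle (h : FlippableQuad a b c d α β γ δ) :
    ({a, b, d} : Finset Plane) ≠ {a, b, c} := by
  intro heq
  have hd : d ∈ ({a, b, c} : Finset Plane) := heq ▸ by simp
  obtain ⟨-, had, hbd⟩ := ne_of_orient_ne_zero h.orient_ne_zero.2.1
  have hcd := (ne_of_orient_ne_zero h.orient_left_neg.ne).1
  simp only [Finset.mem_insert, Finset.mem_singleton] at hd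
  tauto

end FlippableQuad

/-- The triangles that remain after the edge `a b`, shared by the triangles `a b c` and `a b d` of
`T`, is flipped: these two are replaced by `c d a` and `c d b`. -/
noncomputable def flipTriangles (T : Finset (Finset Plane)) (a b c d : Plane) :
    Finset (Finset Plane) :=
  insert {c, d, a} (insert {c, d, b} ((T.erase {a, b, c}).erase {a, b, d}))

section Flip

variable {S : Finset Plane} {T : Finset (Finset Plane)} {a b c d : Plane} {α β γ δ : ℝ}

theorem mem_flipTriangles {t : Finset Plane} : t ∈ flipTriangles T a b c d ↔
    t = {c, d, a} ∨ t = {c, d, b} ∨ t ≠ {a, b, d} ∧ t ≠ {a, b, c} ∧ t ∈ T := by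
  simp only [flipTriangles, Finset.mem_insert, Finset.mem_erase]

namespace IsTriangulation

theorem mem_convexHull_inter_of_mem_edge_triangle (h : FlippableQuad a b c d α β γ δ) {e x : Plane}
    {r : Set Plane} (hr : ¬(a ∈ r ∧ b ∈ r)) (he : e = c ∨ e = d) (hx : orient c d x ≤ 0)
    (hxr : x ∈ convexHull ℝ ({a, b, e} ∩ r)) : x ∈ convexHull ℝ ({c, d, a} ∩ r) := by
  by_cases hb : b ∈ r
  · have hA (p) (hp : p ∈ ({a, b, e} : Set Plane) ∩ r) : p = b ∨ p = e := by
      have ha : p ≠ a := fun heq => hr ⟨heq ▸ hp.2, hb⟩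
      exact hp.1.resolve_left ha
    have he0 : orient d c e = 0 := by
      rcases he with rfl | rfl
      exacts [orient_self_right _ _, orient_self_mid _ _]
    have hface := mem_convexHull_of_convexOn_nonpos (convexOn_orient d c) (fun p hp => by
      rcases hA p hp with rfl | rfl
      exacts [h.symm.orient_left_neg.le, he0.le]) hxr (by rw [orient_swap]; linarith)
    refine convexHull_mono ?_ hface
    rintro p ⟨hp, hp0⟩
    refine ⟨?_, hp.2⟩
    rcases hA p hp with rfl | rfl
    · exact absurd hp0 h.symm.orient_left_neg.ne
    · rcases he with rfl | rfl <;> simp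
  · refine convexHull_mono ?_ hxr
    rintro p ⟨hp, hpr⟩
    refine ⟨?_, hpr⟩
    have hpb : p ≠ b := fun heq => hb (heq ▸ hpr)
    simp only [Set.mem_insert_iff, Set.mem_singleton_iff] at hp ⊢
    grind

theorem flip_inter_subset (hT : IsTriangulation S T) (h : FlippableQuad a b c d α β γ δ)
    (hc : {a, b, c} ∈ T) (hd : {a, b, d} ∈ T) {r : Finset Plane} (hr : r ∈ T)
    (hrc : r ≠ {a, b, c}) (hrd : r ≠ {a, b, d}) :
    convexHull ℝ (({c, d, a} : Finset Plane) : Set Plane) ∩ convexHull ℝ (r : Set Plane) ⊆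
      convexHull ℝ ((({c, d, a} : Finset Plane) : Set Plane) ∩ r) := by
  have hab : ¬(a ∈ (r : Set Plane) ∧ b ∈ (r : Set Plane)) := fun ⟨har, hbr⟩ =>
    (hT.eq_or_eq_of_mem_edge hc hd h.orient_pos
      (by rw [← neg_pos, ← orient_swap]; exact h.symm.orient_pos) hr har hbr).elim hrc hrd
  have hc_inter := hT.inter_subset _ hc r hr
  have hd_inter := hT.inter_subset _ hd r hr
  simp only [Finset.coe_insert, Finset.coe_singleton] at hc_inter hd_inter ⊢
  rintro x ⟨hx, hxr⟩
  have hx_orient := h.orient_nonpos_of_mem_convexHull hx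
  rcases h.convexHull_union.ge (Or.inl hx) with hxc | hxd
  · exact mem_convexHull_inter_of_mem_edge_triangle h hab (Or.inl rfl) hx_orient
      (hc_inter ⟨hxc, hxr⟩)
  · exact mem_convexHull_inter_of_mem_edge_triangle h hab (Or.inr rfl) hx_orient
      (hd_inter ⟨hxd, hxr⟩)

theorem flip_mem_of_mem_convexHull (hT : IsTriangulation S T) (h : FlippableQuad a b c d α β γ δ)
    (hc : {a, b, c} ∈ T) (hd : {a, b, d} ∈ T) {q : Plane} (hq : q ∈ S)
    (hqt : q ∈ convexHull ℝ (({c, d, a} : Finset Plane) : Set Plane)) :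
    q ∈ ({c, d, a} : Finset Plane) := by
  have hqc := hT.mem_of_mem_convexHull _ hc q hq
  have hqd := hT.mem_of_mem_convexHull _ hd q hq
  simp only [Finset.coe_insert, Finset.coe_singleton] at hqt hqc hqd
  have hqb : q ≠ b := fun heq =>
    (h.orient_nonpos_of_mem_convexHull hqt).not_gt (heq ▸ h.orient_right_pos)
  have hmem := (h.convexHull_union.ge (Or.inl hqt)).imp hqc hqd
  simp only [Finset.mem_insert, Finset.mem_singleton] at hmem ⊢
  tauto

theorem inter_subset_of_mem_flipTriangles (hT : IsTriangulation S T)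
    (h : FlippableQuad a b c d α β γ δ) (hc : {a, b, c} ∈ T) (hd : {a, b, d} ∈ T)
    {t t' : Finset Plane} (ht : t ∈ flipTriangles T a b c d)
    (ht' : t' ∈ flipTriangles T a b c d) :
    convexHull ℝ (t : Set Plane) ∩ convexHull ℝ (t' : Set Plane) ⊆
      convexHull ℝ ((t : Set Plane) ∩ t') := by
  have hleft {r} := hT.flip_inter_subset h hc hd (r := r)
  have hright {r} := hT.flip_inter_subset h.symm (Finset.insert_comm a b {d} ▸ hd)
    (Finset.insert_comm a b {c} ▸ hc) (r := r)
  have hmid := h.convexHull_inter_subset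
  rw [Finset.insert_comm b a, Finset.insert_comm b a, Finset.insert_comm d c] at hright
  simp only [← Finset.coe_singleton, ← Finset.coe_insert] at hmid
  rcases mem_flipTriangles.1 ht with rfl | rfl | ⟨htd, htc, ht⟩ <;>
    rcases mem_flipTriangles.1 ht' with rfl | rfl | ⟨htd', htc', ht'⟩
  · rw [Set.inter_self, Set.inter_self]
  · exact hmid
  · exact hleft ht' htc' htd'
  · rwa [Set.inter_comm, Set.inter_comm (({c, d, b} : Finset Plane) : Set Plane)]
  · rw [Set.inter_self, Set.inter_self]
  · exact hright ht' htd' htc'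
  · rw [Set.inter_comm, Set.inter_comm (t : Set Plane)]
    exact hleft ht htc htd
  · rw [Set.inter_comm, Set.inter_comm (t : Set Plane)]
    exact hright ht htd htc
  · exact hT.inter_subset t ht t' ht'

theorem exists_mem_flipTriangles (hT : IsTriangulation S T) (h : FlippableQuad a b c d α β γ δ)
    {x : Plane} (hx : x ∈ convexHull ℝ (S : Set Plane)) (hgen : IsGeneric S x) :
    ∃ t ∈ flipTriangles T a b c d, x ∈ convexHull ℝ (t : Set Plane) := by
  obtain ⟨t, ht, hxt⟩ := hT.cover x hx hgen
  by_cases hmem : t = {a, b, c} ∨ t = {a, b, d}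
  · have hold : x ∈ convexHull ℝ ({a, b, c} : Set Plane) ∪ convexHull ℝ {a, b, d} := by
      rcases hmem with rfl | rfl <;>
        simp only [Finset.coe_insert, Finset.coe_singleton] at hxt
      exacts [Or.inl hxt, Or.inr hxt]
    rcases h.convexHull_union.le hold with hxa | hxb
    · exact ⟨_, mem_flipTriangles.2 (Or.inl rfl), by simpa using hxa⟩
    · exact ⟨_, mem_flipTriangles.2 (Or.inr (Or.inl rfl)), by simpa using hxb⟩
  · rw [not_or] at hmem
    exact ⟨t, mem_flipTriangles.2 (Or.inr (Or.inr ⟨hmem.2, hmem.1, ht⟩)), hxt⟩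

theorem flip (hT : IsTriangulation S T) (h : FlippableQuad a b c d α β γ δ) (hc : {a, b, c} ∈ T)
    (hd : {a, b, d} ∈ T) : IsTriangulation S (flipTriangles T a b c d) where
  subset t ht := by
    have hcS := hT.subset _ hc
    have hdS := hT.subset _ hd
    simp only [Finset.insert_subset_iff, Finset.singleton_subset_iff] at hcS hdS
    rcases mem_flipTriangles.1 ht with rfl | rfl | ⟨-, -, ht⟩
    · simp only [Finset.insert_subset_iff, Finset.singleton_subset_iff]
      exact ⟨hcS.2.2, hdS.2.2, hcS.1⟩
    · simp only [Finset.insert_subset_iff, Finset.singleton_subset_iff]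
      exact ⟨hcS.2.2, hdS.2.2, hcS.2.1⟩
    · exact hT.subset t ht
  isTriangle t ht := by
    rcases mem_flipTriangles.1 ht with rfl | rfl | ⟨-, -, ht⟩
    · exact isTriangle_of_orient_ne_zero h.orient_left_neg.ne
    · exact isTriangle_of_orient_ne_zero h.orient_right_pos.ne'
    · exact hT.isTriangle t ht
  inter_subset _ ht _ ht' := hT.inter_subset_of_mem_flipTriangles h hc hd ht ht'
  mem_of_mem_convexHull t ht q hq hqt := by
    rcases mem_flipTriangles.1 ht with rfl | rfl | ⟨-, -, ht⟩
    · exact hT.flip_mem_of_mem_convexHull h hc hd hq hqt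
    · rw [Finset.insert_comm] at hc hd hqt ⊢
      exact hT.flip_mem_of_mem_convexHull h.symm hd hc hq hqt
    · exact hT.mem_of_mem_convexHull t ht q hq hqt
  cover _ := hT.exists_mem_flipTriangles h

end IsTriangulation

theorem sum_insert_le_add_sum {ι : Type*} [DecidableEq ι] (s : Finset ι) (i : ι) {w : ι → ℝ}
    (hi : 0 ≤ w i) : ∑ j ∈ insert i s, w j ≤ w i + ∑ j ∈ s, w j := by
  by_cases his : i ∈ s
  · rw [Finset.insert_eq_of_mem his]
    exact le_add_of_nonneg_left hi
  · rw [Finset.sum_insert his]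

theorem sum_flipTriangles_lt (h : FlippableQuad a b c d α β γ δ) (hc : {a, b, c} ∈ T)
    (hd : {a, b, d} ∈ T) {w : Finset Plane → ℝ} (hw : ∀ t, IsTriangle t → 0 ≤ w t)
    (hlt : w {c, d, a} + w {c, d, b} < w {a, b, c} + w {a, b, d}) :
    ∑ t ∈ flipTriangles T a b c d, w t < ∑ t ∈ T, w t := by
  have ha_insert := sum_insert_le_add_sum (insert {c, d, b} ((T.erase {a, b, c}).erase {a, b, d}))
    {c, d, a} (hw _ (isTriangle_of_orient_ne_zero h.orient_left_neg.ne))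
  have hb_insert := sum_insert_le_add_sum ((T.erase {a, b, c}).erase {a, b, d})
    {c, d, b} (hw _ (isTriangle_of_orient_ne_zero h.orient_right_pos.ne'))
  have hc_erase := Finset.add_sum_erase T w hc
  have hd_erase := Finset.add_sum_erase (T.erase {a, b, c}) w
    (Finset.mem_erase.2 ⟨h.ne_triangle, hd⟩)
  rw [flipTriangles]
  linarith

namespace IsTriangulation

theorem exists_delaunay_sum_le (hT : IsTriangulation S T) {w : Finset Plane → ℝ}
    (hw : ∀ t, IsTriangle t → 0 ≤ w t)
    (hlt : ∀ {a b c d : Plane} {α β γ δ : ℝ}, FlippableQuad a b c d α β γ δ →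
      w {c, d, a} + w {c, d, b} < w {a, b, c} + w {a, b, d}) :
    ∃ T', IsTriangulation S T' ∧ T' ⊆ delaunayTriangles S ∧ ∑ t ∈ T', w t ≤ ∑ t ∈ T, w t := by
  classical
  have hmem {T'} (hT' : IsTriangulation S T') :
      T' ∈ (S.powersetCard 3).powerset.filter (IsTriangulation S) :=
    Finset.mem_filter.2 ⟨Finset.mem_powerset.2 fun t ht =>
      Finset.mem_powersetCard.2 ⟨hT'.subset t ht, (hT'.isTriangle t ht).1⟩, hT'⟩
  obtain ⟨T', hT', hmin⟩ := Finset.exists_min_image _ (fun T' => ∑ t ∈ T', w t) ⟨T, hmem hT⟩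
  replace hT' := (Finset.mem_filter.1 hT').2
  refine ⟨T', hT', ?_, hmin T (hmem hT)⟩
  by_contra hnd
  obtain ⟨a, b, c, d, α, β, γ, δ, h, hc, hd⟩ := hT'.exists_flippableQuad_of_not_delaunay hnd
  exact (hmin _ (hmem (hT'.flip h hc hd))).not_gt (sum_flipTriangles_lt h hc hd hw (hlt h))

theorem sum_radiusWeight_le_of_delaunay {T' : Finset (Finset Plane)} (hT : IsTriangulation S T)
    (hT' : IsTriangulation S T') (hD : T' ⊆ delaunayTriangles S) {α : ℝ}
    (hlt : ∀ {a b c d : Plane} {α' β γ δ : ℝ}, FlippableQuad a b c d α' β γ δ →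
      radiusWeight α {c, d, a} + radiusWeight α {c, d, b} <
        radiusWeight α {a, b, c} + radiusWeight α {a, b, d}) :
    ∑ t ∈ T', radiusWeight α t ≤ ∑ t ∈ T, radiusWeight α t := by
  obtain ⟨T'', hT'', hD'', hle⟩ :=
    hT.exists_delaunay_sum_le (fun t ht => ht.radiusWeight_nonneg α) hlt
  rwa [sum_radiusWeight_eq_of_delaunay hT' hT'' hD hD'']

end IsTriangulation

end Flip

section AffineHeights

variable {E : Type*} [AddCommGroup E] [Module ℝ E] {S t : Finset E} {h : E → ℝ} {x : E}

theorem affineMap_sum_smul {ι : Type*} (u : E →ᵃ[ℝ] ℝ) {I : Finset ι} {w : ι → ℝ} (p : ι → E)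
    (hw : ∑ i ∈ I, w i = 1) : u (∑ i ∈ I, w i • p i) = ∑ i ∈ I, w i * u (p i) := by
  rw [← I.affineCombination_eq_linear_combination p w hw, I.map_affineCombination p w hw,
    I.affineCombination_eq_linear_combination _ w hw]
  rfl

theorem convexOn_affineMap (u : E →ᵃ[ℝ] ℝ) : ConvexOn ℝ Set.univ u :=
  ⟨convex_univ, fun _ _ _ _ _ _ _ _ hαβ => (Convex.combo_affine_apply hαβ (f := u)).le⟩

theorem affineMap_le_of_mem_convexHull {A : Set E} {u v : E →ᵃ[ℝ] ℝ} (huv : ∀ p ∈ A, u p ≤ v p)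
    (hx : x ∈ convexHull ℝ A) : u x ≤ v x := by
  have hle : (u - v) x ≤ 0 := (convexHull_min (t := {y ∈ Set.univ | (u - v) y ≤ 0})
    (fun p hp => ⟨Set.mem_univ p, sub_nonpos.2 (huv p hp)⟩)
    ((convexOn_affineMap (u - v)).convex_le 0) hx).2
  exact sub_nonpos.1 hle

/-- The heights `h` over `S` are generic if the points of `S` whose lifts `(p, h p)` lie on the
graph of a common affine function are always affinely independent. -/
def IsGenericHeight (S : Finset E) (h : E → ℝ) : Prop :=
  ∀ Q ⊆ S, (∃ u : E →ᵃ[ℝ] ℝ, ∀ q ∈ Q, u q = h q) → AffineIndependent ℝ ((↑) : Q → E)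

theorem IsGenericHeight.convexHull_inter_subset (hh : IsGenericHeight S h) {t' : Finset E}
    (ht : t ⊆ S) (ht' : t' ⊆ S) {u u' : E →ᵃ[ℝ] ℝ} (hu : ∀ p ∈ t, u p = h p)
    (hu' : ∀ p ∈ t', u' p = h p) (hle : ∀ q ∈ S, u q ≤ h q) (hle' : ∀ q ∈ S, u' q ≤ h q) :
    convexHull ℝ (t : Set E) ∩ convexHull ℝ (t' : Set E) ⊆ convexHull ℝ ((t : Set E) ∩ t') := by
  classical
  rintro x ⟨hx, hx'⟩
  have hux : u' x ≤ u x :=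
    affineMap_le_of_mem_convexHull (fun p hp => (hle' p (ht hp)).trans_eq (hu p hp).symm) hx
  have hface : x ∈ convexHull ℝ {p ∈ (t' : Set E) | (u - u') p = 0} :=
    mem_convexHull_of_convexOn_nonpos (convexOn_affineMap (u - u'))
      (fun p hp => sub_nonpos.2 ((hle p (ht' hp)).trans_eq (hu' p hp).symm)) hx' (sub_nonneg.2 hux)
  set Q : Finset E := {q ∈ S | u q = h q}
  have hQ : AffineIndependent ℝ ((↑) : Q → E) :=
    hh Q (Finset.filter_subset _ _) ⟨u, fun q hq => (Finset.mem_filter.1 hq).2⟩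
  have htQ : t ⊆ Q := fun p hp => Finset.mem_filter.2 ⟨ht hp, hu p hp⟩
  have hxQ : x ∈ convexHull ℝ ((t' ∩ Q : Finset E) : Set E) := by
    refine convexHull_mono ?_ hface
    rintro p ⟨hp, hup⟩
    exact Finset.mem_inter.2 ⟨hp, Finset.mem_filter.2
      ⟨ht' hp, (sub_eq_zero.1 hup).trans (hu' p hp)⟩⟩
  have hmem := (hQ.convexHull_inter htQ Finset.inter_subset_right).ge ⟨hx, hxQ⟩
  exact convexHull_mono (Set.inter_subset_inter_right _ (by simp)) hmem

theorem exists_tight_weight {ι : Type*} {I : Finset ι} {w κ : ι → ℝ} (hw : ∀ i ∈ I, 0 < w i)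
    (hκ : 0 < ∑ i ∈ I, κ i) :
    ∃ j ∈ I, ∃ θ > 0, w j = θ * κ j ∧ ∀ i ∈ I, θ * κ i ≤ w i := by
  have hne : {i ∈ I | 0 < κ i}.Nonempty := by
    obtain ⟨i, hi, hκi⟩ := Finset.exists_lt_of_sum_lt (Finset.sum_const_zero.trans_lt hκ)
    exact ⟨i, Finset.mem_filter.2 ⟨hi, hκi⟩⟩
  obtain ⟨j, hj, hmin⟩ := Finset.exists_min_image _ (fun i => w i / κ i) hne
  obtain ⟨hjI, hκj⟩ := Finset.mem_filter.1 hj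
  have hθ : 0 < w j / κ j := div_pos (hw j hjI) hκj
  refine ⟨j, hjI, w j / κ j, hθ, (div_mul_cancel₀ _ hκj.ne').symm, fun i hi => ?_⟩
  rcases lt_or_ge 0 (κ i) with hκi | hκi
  · exact (le_div_iff₀ hκi).1 (hmin i (Finset.mem_filter.2 ⟨hi, hκi⟩))
  · exact (mul_nonpos_of_nonneg_of_nonpos hθ.le hκi).trans (hw i hi).le

theorem mem_convexHull_insert_of_weights [DecidableEq E] {w : E → ℝ} {θ : ℝ} {q : E} (hq : q ∉ t)
    (hθ : 0 ≤ θ) (hw : ∀ p ∈ t, 0 ≤ w p) (hsum : θ + ∑ p ∈ t, w p = 1) :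
    θ • q + ∑ p ∈ t, w p • p ∈ convexHull ℝ (insert q t : Finset E) := by
  have hupdate (p) (hp : p ∈ t) : Function.update w q θ p = w p :=
    Function.update_of_ne (ne_of_mem_of_not_mem hp hq) _ _
  refine Finset.mem_convexHull'.2 ⟨Function.update w q θ, ?_, ?_, ?_⟩
  · refine (Finset.forall_mem_insert _ _ _).2
      ⟨by rwa [Function.update_self], fun p hp => by rw [hupdate p hp]; exact hw p hp⟩
  · rwa [Finset.sum_insert hq, Function.update_self, Finset.sum_congr rfl hupdate]
  · rw [Finset.sum_insert hq, Function.update_self,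
      Finset.sum_congr rfl fun p hp => by rw [hupdate p hp]]

theorem exists_lowering_exchange [DecidableEq E] {w κ : E → ℝ} {q : E} (hq : q ∉ t)
    (hw : ∀ p ∈ t, 0 < w p) (hw_sum : ∑ p ∈ t, w p = 1) (hwx : ∑ p ∈ t, w p • p = x)
    (hκ_sum : ∑ p ∈ t, κ p = 1) (hκq : ∑ p ∈ t, κ p • p = q) :
    ∃ j ∈ t, x ∈ convexHull ℝ (insert q (t.erase j) : Finset E) ∧
      ∀ u v : E →ᵃ[ℝ] ℝ, (∀ p ∈ t.erase j, v p = u p) → v q < u q → v x < u x := by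
  obtain ⟨j, hj, θ, hθ, hwj, hle⟩ := exists_tight_weight hw (hκ_sum.symm ▸ one_pos)
  refine ⟨j, hj, ?_, fun u v huv hlt => ?_⟩
  · have hsum : ∑ p ∈ t.erase j, (w p - θ * κ p) = 1 - θ := by
      rw [Finset.sum_erase (f := fun p => w p - θ * κ p) _ (sub_eq_zero.2 hwj),
        Finset.sum_sub_distrib, ← Finset.mul_sum, hw_sum, hκ_sum, mul_one]
    have hcomb : θ • q + ∑ p ∈ t.erase j, (w p - θ * κ p) • p = x := by
      rw [Finset.sum_erase (f := fun p => (w p - θ * κ p) • p) _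
        (by rw [sub_eq_zero.2 hwj, zero_smul])]
      simp only [sub_smul, mul_smul, Finset.sum_sub_distrib, ← Finset.smul_sum, hwx, hκq,
        add_sub_cancel]
    rw [← hcomb]
    exact mem_convexHull_insert_of_weights (fun h => hq (Finset.mem_of_mem_erase h)) hθ.le
      (fun p hp => sub_nonneg.2 (hle p (Finset.mem_of_mem_erase hp))) (by rw [hsum, add_sub_cancel])
  · have hdiff (p) (hp : p ∈ t) (hpj : p ≠ j) : (v - u) p = 0 :=
      sub_eq_zero.2 (huv p (Finset.mem_erase.2 ⟨hpj, hp⟩))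
    have hsingle (c : E → ℝ) (hc : ∑ p ∈ t, c p = 1) :
        (v - u) (∑ p ∈ t, c p • p) = c j * (v - u) j := by
      rw [affineMap_sum_smul (v - u) (fun p => p) hc]
      exact Finset.sum_eq_single_of_mem j hj fun p hp hpj => by rw [hdiff p hp hpj, mul_zero]
    refine sub_neg.1 (?_ : (v - u) x < 0)
    rw [← hwx, hsingle w hw_sum, hwj, mul_assoc, ← hsingle κ hκ_sum, hκq]
    exact mul_neg_of_pos_of_neg hθ (sub_neg.2 hlt)

end AffineHeights

namespace IsTriangle

variable {t : Finset Plane}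

/-- The affine basis of the plane given by the vertices of a triangle. -/
noncomputable def affineBasis (ht : IsTriangle t) : AffineBasis t ℝ Plane :=
  ⟨(↑), ht.2, ht.2.affineSpan_eq_top_iff_card_eq_finrank_add_one.2 (by simp [ht.1])⟩

theorem exists_affineMap_eq (ht : IsTriangle t) (h : Plane → ℝ) :
    ∃ u : Plane →ᵃ[ℝ] ℝ, ∀ p ∈ t, u p = h p := by
  have hcoord (p q : t) : ht.affineBasis.coord p q = if p = q then 1 else 0 :=
    ht.affineBasis.coord_apply p q
  refine ⟨(Fintype.linearCombination ℝ fun p : t => h p).toAffineMap.comp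
    ht.affineBasis.coords, fun q hq => ?_⟩
  lift q to t using hq
  simp [Fintype.linearCombination_apply, hcoord]

theorem exists_weights (ht : IsTriangle t) (q : Plane) :
    ∃ κ : Plane → ℝ, ∑ p ∈ t, κ p = 1 ∧ ∑ p ∈ t, κ p • p = q := by
  have hsum : ∑ p : t, ht.affineBasis.coord p q = 1 := ht.affineBasis.sum_coord_apply_eq_one q
  have hcomb : ∑ p : t, ht.affineBasis.coord p q • (p : Plane) = q :=
    ht.affineBasis.linear_combination_coord_eq_self q
  refine ⟨fun p => if hp : p ∈ t then ht.affineBasis.coord ⟨p, hp⟩ q else 0, ?_, ?_⟩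
  · rw [← Finset.sum_coe_sort t]
    simpa using hsum
  · rw [← Finset.sum_coe_sort t]
    simpa using hcomb

end IsTriangle

theorem IsGeneric.exists_isTriangle {S : Finset Plane} {x : Plane} (hgen : IsGeneric S x)
    (hx : x ∈ convexHull ℝ (S : Set Plane)) :
    ∃ t ⊆ S, IsTriangle t ∧ x ∈ convexHull ℝ (t : Set Plane) := by
  rw [convexHull_eq_union] at hx
  simp only [Set.mem_iUnion, exists_prop] at hx
  obtain ⟨t, ht, hind, hxt⟩ := hx
  have htS : t ⊆ S := mod_cast ht
  refine ⟨t, htS, ⟨?_, hind⟩, hxt⟩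
  have hle : t.card ≤ 3 := card_le_three_of_affineIndependent hind
  by_contra hne
  exact hgen.notMem_convexHull htS (by omega) hxt

/-- The triangles spanned by points of `S` that lift to faces of the lower convex hull of the graph
of the heights `h` over `S`. -/
noncomputable def regularTriangles (S : Finset Plane) (h : Plane → ℝ) : Finset (Finset Plane) :=
  open Classical in {t ∈ S.powerset | IsTriangle t ∧
    ∃ u : Plane →ᵃ[ℝ] ℝ, (∀ p ∈ t, u p = h p) ∧ ∀ q ∈ S, u q ≤ h q}

theorem mem_regularTriangles {S t : Finset Plane} {h : Plane → ℝ} :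
    t ∈ regularTriangles S h ↔ t ⊆ S ∧ IsTriangle t ∧
      ∃ u : Plane →ᵃ[ℝ] ℝ, (∀ p ∈ t, u p = h p) ∧ ∀ q ∈ S, u q ≤ h q := by
  simp only [regularTriangles, Finset.mem_filter, Finset.mem_powerset]

theorem exists_mem_regularTriangles {S : Finset Plane} (h : Plane → ℝ) {x : Plane}
    (hgen : IsGeneric S x) (hx : x ∈ convexHull ℝ (S : Set Plane)) :
    ∃ t ∈ regularTriangles S h, x ∈ convexHull ℝ (t : Set Plane) := by
  classical
  set C : Finset (Finset Plane) :=
    {t ∈ S.powerset | IsTriangle t ∧ x ∈ convexHull ℝ (t : Set Plane)}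
  have hC {t} : t ∈ C ↔ t ⊆ S ∧ IsTriangle t ∧ x ∈ convexHull ℝ (t : Set Plane) := by
    simp only [C, Finset.mem_filter, Finset.mem_powerset]
  have hinterpolant (t : Finset Plane) : ∃ u : Plane →ᵃ[ℝ] ℝ, t ∈ C → ∀ p ∈ t, u p = h p := by
    by_cases ht : t ∈ C
    · exact ((hC.1 ht).2.1.exists_affineMap_eq h).imp fun _ hu _ => hu
    · exact ⟨0, fun h => absurd h ht⟩
  choose u hu using hinterpolant
  obtain ⟨t₀, ht₀⟩ := hgen.exists_isTriangle hx
  obtain ⟨t, htC, hmin⟩ := C.exists_min_image (fun t => u t x) ⟨t₀, hC.2 ht₀⟩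
  obtain ⟨htS, ht, hxt⟩ := hC.1 htC
  refine ⟨t, mem_regularTriangles.2 ⟨htS, ht, u t, hu t htC, fun q hq => ?_⟩, hxt⟩
  by_contra! hlt
  obtain ⟨w, hw, hw_sum, hwx⟩ := hgen.exists_pos_weights htS ht.1.le hxt
  obtain ⟨κ, hκ_sum, hκq⟩ := ht.exists_weights q
  obtain ⟨j, hj, hxj, hlower⟩ :=
    exists_lowering_exchange (fun hqt => hlt.ne' (hu t htC q hqt)) hw hw_sum hwx hκ_sum hκq
  have hsub : insert q (t.erase j) ⊆ S :=
    Finset.insert_subset hq ((t.erase_subset j).trans htS)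
  obtain ⟨t', ht', htri', hxt'⟩ :=
    IsGeneric.exists_isTriangle (fun p hp r hr => hgen p (hsub hp) r (hsub hr)) hxj
  obtain rfl : t' = insert q (t.erase j) := Finset.eq_of_subset_of_card_le ht' <| by
    rw [htri'.1, ← ht.1, ← Finset.card_erase_add_one hj]
    exact Finset.card_insert_le _ _
  have htC' : insert q (t.erase j) ∈ C := hC.2 ⟨hsub, htri', hxj⟩
  refine (hmin _ htC').not_gt (hlower (u t) _ (fun p hp => ?_) ?_)
  · rw [hu _ htC' p (Finset.mem_insert_of_mem hp), hu t htC p (Finset.mem_of_mem_erase hp)]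
  · rwa [hu _ htC' q (Finset.mem_insert_self _ _)]

theorem mem_of_mem_convexHull_of_dist_le {E : Type*} [NormedAddCommGroup E] [NormedSpace ℝ E]
    [StrictConvexSpace ℝ E] {A : Set E} {o q : E} (hA : ∀ p ∈ A, dist p o ≤ dist q o)
    (hq : q ∈ convexHull ℝ A) : q ∈ A := by
  obtain _ | _ := subsingleton_or_nontrivial E
  · obtain ⟨p, hp⟩ := convexHull_nonempty_iff.1 ⟨q, hq⟩
    exact Subsingleton.elim p q ▸ hp
  have hball : convexHull ℝ A ⊆ Metric.closedBall o (dist q o) :=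
    convexHull_min hA (convex_closedBall _ _)
  refine extremePoints_convexHull_subset (𝕜 := ℝ)
    (inter_extremePoints_subset_extremePoints_of_subset hball ⟨hq, ?_⟩)
  rw [StrictConvexSpace.extremePoints_closedBall_eq_sphere]
  exact Metric.mem_sphere.2 rfl

theorem mem_of_mem_convexHull_of_delaunay {S t : Finset Plane} (ht : t ∈ delaunayTriangles S)
    {q : Plane} (hq : q ∈ S) (hqt : q ∈ convexHull ℝ (t : Set Plane)) : q ∈ t := by
  obtain ⟨-, htri, s, hts, hpower⟩ := mem_delaunayTriangles.1 ht
  obtain ⟨p₀, hp₀⟩ := htri.nonempty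
  have hle : s.radius ≤ dist q s.center := (Sphere.power_nonneg_iff_radius_le_dist_center
    (Sphere.radius_nonneg_of_mem (hts p₀ hp₀))).1 (hpower q hq)
  exact mem_of_mem_convexHull_of_dist_le (fun p hp => (hts p hp).trans_le hle) hqt

theorem IsGenericHeight.isTriangulation_regularTriangles {S : Finset Plane} {h : Plane → ℝ}
    (hh : IsGenericHeight S h) (hD : regularTriangles S h ⊆ delaunayTriangles S) :
    IsTriangulation S (regularTriangles S h) where
  subset _ ht := (mem_regularTriangles.1 ht).1
  isTriangle _ ht := (mem_regularTriangles.1 ht).2.1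
  inter_subset t ht t' ht' := by
    obtain ⟨hS, -, u, hu, hle⟩ := mem_regularTriangles.1 ht
    obtain ⟨hS', -, u', hu', hle'⟩ := mem_regularTriangles.1 ht'
    exact hh.convexHull_inter_subset hS hS' hu hu' hle hle'
  mem_of_mem_convexHull _ ht _ hq hqt := mem_of_mem_convexHull_of_delaunay (hD ht) hq hqt
  cover _ hx hgen := exists_mem_regularTriangles h hgen hx

theorem dense_sum_mul_ne_zero {ι : Type*} {Q : Finset ι} {c : ι → ℝ} (hc : ∃ i ∈ Q, c i ≠ 0) :
    Dense {h : ι → ℝ | ∑ i ∈ Q, c i * h i ≠ 0} := by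
  classical
  obtain ⟨j, hj, hcj⟩ := hc
  let L : (ι → ℝ) →ₗ[ℝ] ℝ := ∑ i ∈ Q, c i • LinearMap.proj i
  have hL (h : ι → ℝ) : L h = ∑ i ∈ Q, c i * h i := by simp [L, LinearMap.sum_apply]
  have hne : L (Pi.single j 1) ≠ 0 := by
    rw [hL, Finset.sum_eq_single_of_mem j hj fun i _ hij => by
      rw [Pi.single_eq_of_ne hij, mul_zero], Pi.single_eq_same, mul_one]
    exact hcj
  simp only [← hL]
  rw [show {h | L h ≠ 0} = ((LinearMap.ker L : Set (ι → ℝ)))ᶜ from rfl,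
    ← interior_eq_empty_iff_dense_compl, ← Set.not_nonempty_iff_eq_empty]
  exact fun h => hne (LinearMap.ker_eq_top.1 (Submodule.eq_top_of_nonempty_interior' _ h) ▸ rfl)

theorem dense_isGenericHeight {E : Type*} [AddCommGroup E] [Module ℝ E] (S : Finset E) :
    Dense {h : E → ℝ | IsGenericHeight S h} := by
  classical
  have hdependence (Q : Finset E) : ∃ c : E → ℝ, ¬ AffineIndependent ℝ ((↑) : Q → E) →
      ∑ p ∈ Q, c p • p = 0 ∧ ∑ p ∈ Q, c p = 0 ∧ ∃ p ∈ Q, c p ≠ 0 := by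
    by_cases hQ : AffineIndependent ℝ ((↑) : Q → E)
    · exact ⟨0, fun h => absurd hQ h⟩
    · exact (exists_nontrivial_relation_sum_zero_of_not_affine_ind hQ).imp fun _ hc _ => hc
  choose c hc using hdependence
  set D : Finset (Finset E) := {Q ∈ S.powerset | ¬ AffineIndependent ℝ ((↑) : Q → E)}
  have hopen (Q : Finset E) : IsOpen {h : E → ℝ | ∑ p ∈ Q, c Q p * h p ≠ 0} :=
    isOpen_ne_fun (by fun_prop) continuous_const
  have hdense : Dense (⋂₀ ((fun Q : Finset E => {h : E → ℝ | ∑ p ∈ Q, c Q p * h p ≠ 0}) '' D)) := by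
    refine (D.finite_toSet.image _).dense_sInter ?_ ?_ <;> rintro _ ⟨Q, hQ, rfl⟩
    · exact hopen Q
    · exact dense_sum_mul_ne_zero (hc Q (Finset.mem_filter.1 hQ).2).2.2
  refine hdense.mono fun h hh Q hQ ⟨u, hu⟩ => ?_
  by_contra hdep
  obtain ⟨hcomb, hsum, -⟩ := hc Q hdep
  refine hh _ ⟨Q, Finset.mem_filter.2 ⟨Finset.mem_powerset.2 hQ, hdep⟩, rfl⟩ ?_
  calc ∑ p ∈ Q, c Q p * h p = ∑ p ∈ Q, c Q p * u p :=
        Finset.sum_congr rfl fun p hp => by rw [hu p hp]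
    _ = u.linear (∑ p ∈ Q, c Q p • p) + (∑ p ∈ Q, c Q p) * u 0 := by
        rw [map_sum, Finset.sum_mul, ← Finset.sum_add_distrib]
        refine Finset.sum_congr rfl fun p _ => ?_
        rw [map_smul, smul_eq_mul, ← mul_add, ← vadd_eq_add, ← u.map_vadd, vadd_eq_add, add_zero]
    _ = 0 := by rw [hcomb, hsum, map_zero, zero_mul, add_zero]

theorem eventually_regularTriangles_subset_delaunayTriangles (S : Finset Plane) :
    ∀ᶠ h in 𝓝 (fun p : Plane => ‖p‖ ^ 2), regularTriangles S h ⊆ delaunayTriangles S := by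
  suffices hbad : ∀ t ∈ S.powerset, ∀ᶠ h in 𝓝 (fun p : Plane => ‖p‖ ^ 2),
      t ∈ regularTriangles S h → t ∈ delaunayTriangles S by
    filter_upwards [(Finset.eventually_all _).2 hbad] with h hh t ht
    exact hh t (Finset.mem_powerset.2 (mem_regularTriangles.1 ht).1) ht
  intro t htS
  by_cases htD : t ∈ delaunayTriangles S
  · exact Eventually.of_forall fun _ _ => htD
  by_cases htri : IsTriangle t
  swap
  · exact Eventually.of_forall fun _ ht => absurd (mem_regularTriangles.1 ht).2.1 htri
  obtain ⟨o, ho⟩ := htri.exists_circumcircle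
  obtain ⟨q, hq, hpower⟩ : ∃ q ∈ S, (⟨o, triangleCircumradius t⟩ : Sphere Plane).power q < 0 := by
    by_contra! hpower
    exact htD (mem_delaunayTriangles.2
      ⟨Finset.mem_powerset.1 htS, htri, ⟨o, triangleCircumradius t⟩, ho, hpower⟩)
  obtain ⟨κ, hκ_sum, hκq⟩ := htri.exists_weights q
  have hlifted : ‖q‖ ^ 2 < ∑ p ∈ t, κ p * ‖p‖ ^ 2 := by
    have hkey := sum_mul_power_sub_power hκ_sum hκq ⟨o, triangleCircumradius t⟩ ⟨0, 0⟩
    rw [Finset.sum_congr rfl fun p hp => by rw [sphere_power_eq_zero (ho p hp)]] at hkey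
    simp only [Sphere.power, dist_zero_right, zero_sub, mul_neg, Finset.sum_neg_distrib,
      ne_eq, OfNat.ofNat_ne_zero, not_false_eq_true, zero_pow, sub_zero] at hkey hpower
    linarith
  have hopen : IsOpen {h : Plane → ℝ | h q < ∑ p ∈ t, κ p * h p} :=
    isOpen_lt (by fun_prop) (by fun_prop)
  filter_upwards [hopen.mem_nhds hlifted] with h hh ht
  obtain ⟨-, -, u, hu, hle⟩ := mem_regularTriangles.1 ht
  refine absurd (hle q hq) (not_le.2 ?_)
  rw [← hκq, affineMap_sum_smul u (fun p => p) hκ_sum, hκq,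
    Finset.sum_congr rfl fun p hp => by rw [hu p hp]]
  exact hh

theorem exists_delaunay_height (S : Finset Plane) :
    ∃ h, IsGenericHeight S h ∧ regularTriangles S h ⊆ delaunayTriangles S :=
  (mem_closure_iff_frequently.1 (dense_isGenericHeight S _)).and_eventually
    (eventually_regularTriangles_subset_delaunayTriangles S) |>.exists

/-- The simplicial complex of all nonempty faces of the triangles of a triangulation. -/
def IsTriangulation.toGeometric {S : Finset Plane} {T : Finset (Finset Plane)}
    (hT : IsTriangulation S T) {t₀ : Finset Plane} (ht₀ : IsTriangle t₀) (ht₀S : t₀ ⊆ S) :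
    GeometricTriangulation S where
  faces := {f | f.Nonempty ∧ ∃ t ∈ T, f ⊆ t}
  isRelLowerSet_faces _ := fun ⟨hf, t, ht, hft⟩ => ⟨hf, fun _ hgf hg => ⟨hg, t, ht, hgf.trans hft⟩⟩
  indep := fun ⟨_, t, ht, hft⟩ => (hT.isTriangle t ht).2.mono (Finset.coe_subset.2 hft)
  inter_subset_convexHull := by
    rintro f g ⟨-, t, ht, hft⟩ ⟨-, t', ht', hgt'⟩ x ⟨hxf, hxg⟩
    have hxtt' := hT.inter_subset t ht t' ht'
      ⟨convexHull_mono (Finset.coe_subset.2 hft) hxf,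
        convexHull_mono (Finset.coe_subset.2 hgt') hxg⟩
    rw [← Finset.coe_inter] at hxtt'
    have hxft' : x ∈ convexHull ℝ ((f ∩ (t ∩ t') : Finset Plane) : Set Plane) := by
      rw [Finset.coe_inter, (hT.isTriangle t ht).2.convexHull_inter hft Finset.inter_subset_left]
      exact ⟨hxf, hxtt'⟩
    have hxfg : x ∈ convexHull ℝ (((f ∩ (t ∩ t') : Finset Plane) : Set Plane) ∩ g) := by
      rw [(hT.isTriangle t' ht').2.convexHull_inter
        (Finset.inter_subset_right.trans Finset.inter_subset_right) hgt']
      exact ⟨hxft', hxg⟩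
    exact convexHull_mono
      (Set.inter_subset_inter_left _ (Finset.coe_subset.2 Finset.inter_subset_left)) hxfg
  vertices_eq := by
    ext p
    refine ⟨fun ⟨_, t, ht, hpt⟩ => hT.subset t ht (Finset.singleton_subset_iff.1 hpt), fun hp => ?_⟩
    obtain ⟨t, ht, hpt⟩ := hT.exists_mem ht₀ ht₀S (subset_convexHull ℝ _ hp)
    exact ⟨Finset.singleton_nonempty p, t, ht,
      Finset.singleton_subset_iff.2 (hT.mem_of_mem_convexHull t ht p hp hpt)⟩
  space_eq := by
    ext x
    rw [Geometry.SimplicialComplex.mem_space_iff]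
    refine ⟨fun ⟨f, ⟨_, t, ht, hft⟩, hx⟩ =>
      convexHull_mono (Finset.coe_subset.2 (hft.trans (hT.subset t ht))) hx, fun hx => ?_⟩
    obtain ⟨t, ht, hxt⟩ := hT.exists_mem ht₀ ht₀S hx
    exact ⟨t, ⟨(hT.isTriangle t ht).nonempty, t, ht, Finset.Subset.refl t⟩, hxt⟩

theorem exists_delaunay_of_isTriangle {S t : Finset Plane} (ht : IsTriangle t) (htS : t ⊆ S) :
    ∃ D : GeometricTriangulation S, D.IsDelaunay := by
  obtain ⟨h, hgen, hD⟩ := exists_delaunay_height S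
  have hT := hgen.isTriangulation_regularTriangles hD
  refine ⟨hT.toGeometric ht htS, fun f hf => ?_⟩
  obtain ⟨⟨-, t', ht', hft'⟩, hcard⟩ := (GeometricTriangulation.mem_triangles _ f).1 hf
  rw [Finset.eq_of_subset_of_card_le hft' (by rw [hcard, (hT.isTriangle t' ht').1])]
  exact hD ht'

theorem mem_convexHull_of_mem_convexHull_insert {𝕜 E : Type*} [Field 𝕜] [LinearOrder 𝕜]
    [IsStrictOrderedRing 𝕜] [AddCommGroup E] [Module 𝕜 E] {s : Set E} {A : AffineSubspace 𝕜 E}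
    {p x : E} (hsA : s ⊆ A) (hp : p ∉ A) (hx : x ∈ A) (hxs : x ∈ convexHull 𝕜 (insert p s)) :
    x ∈ convexHull 𝕜 s := by
  rcases s.eq_empty_or_nonempty with rfl | hs
  · rw [insert_empty_eq, convexHull_singleton, Set.mem_singleton_iff] at hxs
    exact absurd (hxs ▸ hx) hp
  rw [convexHull_insert hs, convexJoin_singleton_left, Set.mem_iUnion₂] at hxs
  obtain ⟨y, hy, hxy⟩ := hxs
  by_cases hne : x = y
  · exact hne ▸ hy
  have hyA : y ∈ A := convexHull_min hsA A.convex hy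
  have hline : p ∈ line[𝕜, y, x] :=
    (mem_segment_iff_wbtw.1 hxy).left_mem_affineSpan_of_right_ne (Ne.symm hne)
  exact absurd (affineSpan_pair_le_of_mem_of_mem hyA hx hline) hp

/-- The subcomplex of the faces spanned by `S` in a triangulation of `S` with one more point `p`
outside the affine span of `S`. -/
def GeometricTriangulation.eraseApex {S : Finset Plane} {p : Plane}
    (D : GeometricTriangulation (insert p S)) (hp : p ∉ affineSpan ℝ (S : Set Plane)) :
    GeometricTriangulation S where
  faces := {f | f ∈ D.faces ∧ f ⊆ S}
  isRelLowerSet_faces _ := fun ⟨hf, hfS⟩ => ⟨D.nonempty_of_mem_faces hf, fun _ hgf hg =>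
    ⟨D.down_closed hf hgf hg, hgf.trans hfS⟩⟩
  indep hf := D.indep hf.1
  inter_subset_convexHull hf hg := D.inter_subset_convexHull hf.1 hg.1
  vertices_eq := by
    ext q
    exact ⟨fun ⟨_, hq⟩ => Finset.singleton_subset_iff.1 hq, fun hq =>
      ⟨D.singleton_mem_faces.2 (Finset.mem_insert_of_mem hq), Finset.singleton_subset_iff.2 hq⟩⟩
  space_eq := by
    ext x
    rw [Geometry.SimplicialComplex.mem_space_iff]
    refine ⟨fun ⟨f, ⟨_, hfS⟩, hx⟩ => convexHull_mono (Finset.coe_subset.2 hfS) hx, fun hx => ?_⟩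
    have hxD : x ∈ D.space := by
      rw [D.space_eq]
      exact convexHull_mono (Finset.coe_subset.2 (Finset.subset_insert p S)) hx
    obtain ⟨f, hf, hxf⟩ := Geometry.SimplicialComplex.mem_space_iff.1 hxD
    have hfS : f.erase p ⊆ S := Finset.subset_insert_iff.1 (D.subset_of_mem_faces hf)
    have hxe : x ∈ convexHull ℝ ((f.erase p : Finset Plane) : Set Plane) := by
      refine mem_convexHull_of_mem_convexHull_insert
        ((Finset.coe_subset.2 hfS).trans (subset_affineSpan ℝ _)) hp
        (convexHull_subset_affineSpan _ hx) ?_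
      rw [← Finset.coe_insert]
      exact convexHull_mono (Finset.coe_subset.2 (Finset.insert_erase_subset p f)) hxf
    have hne : (f.erase p).Nonempty := Finset.coe_nonempty.1 (convexHull_nonempty_iff.1 ⟨x, hxe⟩)
    exact ⟨f.erase p, ⟨D.down_closed hf (Finset.erase_subset p f) hne, hfS⟩, hxe⟩

theorem GeometricTriangulation.IsDelaunay.eraseApex {S : Finset Plane} {p : Plane}
    {D : GeometricTriangulation (insert p S)} (hD : D.IsDelaunay)
    (hp : p ∉ affineSpan ℝ (S : Set Plane)) : (D.eraseApex hp).IsDelaunay := fun f hf => by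
  obtain ⟨⟨hfD, hfS⟩, hcard⟩ := (mem_triangles _ f).1 hf
  obtain ⟨-, htri, s, hs, hpower⟩ :=
    mem_delaunayTriangles.1 (hD ((D.mem_triangles f).2 ⟨hfD, hcard⟩))
  exact mem_delaunayTriangles.2
    ⟨hfS, htri, s, hs, fun q hq => hpower q (Finset.mem_insert_of_mem hq)⟩

theorem exists_notMem_line (a b : Plane) : ∃ p, p ∉ line[ℝ, a, b] := by
  by_contra! h
  exact affineSpan_ne_top_of_collinear (by simp) (collinear_pair ℝ a b)
    ((AffineSubspace.coe_eq_univ_iff _).1 (Set.eq_univ_of_forall h))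

theorem exists_delaunay_of_insert {S : Finset Plane} {a b : Plane}
    (hS : (S : Set Plane) ⊆ line[ℝ, a, b])
    (hinsert : ∀ p ∉ line[ℝ, a, b], ∃ D : GeometricTriangulation (insert p S), D.IsDelaunay) :
    ∃ D : GeometricTriangulation S, D.IsDelaunay := by
  obtain ⟨p, hp⟩ := exists_notMem_line a b
  obtain ⟨D, hD⟩ := hinsert p hp
  exact ⟨_, hD.eraseApex fun hpS => hp (affineSpan_le.2 hS hpS)⟩

theorem isTriangle_of_notMem_line {a b c : Plane} (hab : a ≠ b) (hc : c ∉ line[ℝ, a, b]) :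
    IsTriangle {a, b, c} :=
  isTriangle_of_orient_ne_zero fun h =>
    hc ((collinear_iff_orient.2 h).mem_affineSpan_of_mem_of_ne (by simp) (by simp) (by simp) hab)

theorem exists_delaunay_of_ne {S : Finset Plane} {a b : Plane} (ha : a ∈ S) (hb : b ∈ S)
    (hab : a ≠ b) : ∃ D : GeometricTriangulation S, D.IsDelaunay := by
  by_cases hS : (S : Set Plane) ⊆ line[ℝ, a, b]
  · refine exists_delaunay_of_insert hS fun p hp =>
      exists_delaunay_of_isTriangle (isTriangle_of_notMem_line hab hp) ?_
    simp only [Finset.insert_subset_iff, Finset.singleton_subset_iff, Finset.mem_insert]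
    tauto
  · obtain ⟨c, hc, hcl⟩ := Set.not_subset.1 hS
    refine exists_delaunay_of_isTriangle (isTriangle_of_notMem_line hab hcl) ?_
    simp only [Finset.insert_subset_iff, Finset.singleton_subset_iff]
    exact ⟨ha, hb, hc⟩

theorem exists_delaunay (S : Finset Plane) : ∃ D : GeometricTriangulation S, D.IsDelaunay := by
  rcases S.eq_empty_or_nonempty with rfl | ⟨a, ha⟩
  · have hvertices : (⊥ : Geometry.SimplicialComplex ℝ Plane).vertices = ∅ :=
      Set.eq_empty_of_forall_notMem fun _ => Set.notMem_empty _
    refine ⟨⟨⊥, ?_, ?_⟩, fun f hf => absurd ((GeometricTriangulation.mem_triangles _ f).1 hf).1 ?_⟩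
    · rw [hvertices, Finset.coe_empty]
    · rw [Geometry.SimplicialComplex.space_bot, Finset.coe_empty, convexHull_empty]
    · exact Set.notMem_empty f
  by_cases hS : ∃ b ∈ S, a ≠ b
  · obtain ⟨b, hb, hab⟩ := hS
    exact exists_delaunay_of_ne ha hb hab
  push Not at hS
  refine exists_delaunay_of_insert (a := a) (b := a) (fun c hc => ?_) fun p hp => ?_
  · exact hS c hc ▸ left_mem_affineSpan_pair ℝ a a
  · refine exists_delaunay_of_ne (Finset.mem_insert_self p S) (Finset.mem_insert_of_mem ha) ?_
    exact fun hpa => hp (hpa ▸ left_mem_affineSpan_pair ℝ a a)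

theorem segment_eq_union {𝕜 E : Type*} [Field 𝕜] [LinearOrder 𝕜] [IsStrictOrderedRing 𝕜]
    [AddCommGroup E] [Module 𝕜 E] {a b m : E} (hm : m ∈ segment 𝕜 a b) :
    segment 𝕜 a b = segment 𝕜 a m ∪ segment 𝕜 m b := by
  refine Set.Subset.antisymm ?_ (Set.union_subset
    ((convex_segment a b).segment_subset (left_mem_segment 𝕜 a b) hm)
    ((convex_segment a b).segment_subset hm (right_mem_segment 𝕜 a b)))
  have hline : m ∈ Set.range (AffineMap.lineMap a b : 𝕜 → E) := by
    rw [segment_eq_image_lineMap] at hm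
    exact Set.image_subset_range _ _ hm
  rw [← insert_endpoints_openSegment]
  rintro x (rfl | rfl | hx)
  · exact Or.inl (left_mem_segment 𝕜 x m)
  · exact Or.inr (right_mem_segment 𝕜 m x)
  · rcases openSegment_subset_union a b hline hx with rfl | hx | hx
    · exact Or.inl (right_mem_segment 𝕜 a x)
    · exact Or.inl (openSegment_subset_segment 𝕜 a m hx)
    · exact Or.inr (openSegment_subset_segment 𝕜 m b hx)

theorem convexHull_triple_eq_union {𝕜 E : Type*} [Field 𝕜] [LinearOrder 𝕜]
    [IsStrictOrderedRing 𝕜] [AddCommGroup E] [Module 𝕜 E] {a b m : E} (hm : m ∈ segment 𝕜 a b)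
    (c : E) :
    convexHull 𝕜 ({a, b, c} : Set E) = convexHull 𝕜 {a, m, c} ∪ convexHull 𝕜 {m, b, c} := by
  rw [← convexJoin_segment_singleton, segment_eq_union hm, convexJoin_union_left,
    convexJoin_segment_singleton, convexJoin_segment_singleton]

theorem volume_convexHull_eq_zero_of_collinear {s : Set Plane} (hs : Collinear ℝ s) :
    volume (convexHull ℝ s) = 0 :=
  measure_mono_null (convexHull_subset_affineSpan s)
    (Measure.addHaar_affineSubspace _ _ (affineSpan_ne_top_of_collinear (by simp) hs))

theorem volume_setOf_orient_eq_zero {a b : Plane} (hab : a ≠ b) :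
    volume {x | orient a b x = 0} = 0 := by
  refine measure_mono_null (fun x hx => ?_) (Measure.addHaar_affineSubspace volume line[ℝ, a, b]
    (affineSpan_ne_top_of_collinear (by simp) (collinear_pair ℝ a b)))
  obtain ⟨τ, rfl⟩ := exists_lineMap_eq_of_orient_eq_zero hab hx
  exact AffineMap.lineMap_mem_affineSpan_pair τ a b

theorem aedisjoint_convexHull_triple {a b m : Plane} (hm : m ∈ segment ℝ a b) (c : Plane) :
    AEDisjoint volume (convexHull ℝ ({a, m, c} : Set Plane)) (convexHull ℝ {m, b, c}) := by
  by_cases h : orient a b c = 0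
  · refine measure_mono_null (fun x hx => ?_)
      (volume_convexHull_eq_zero_of_collinear (collinear_iff_orient.2 h))
    rw [convexHull_triple_eq_union hm]
    exact Or.inl hx.1
  rw [segment_eq_image_lineMap] at hm
  obtain ⟨τ, ⟨hτ0, hτ1⟩, rfl⟩ := hm
  set m : Plane := AffineMap.lineMap a b τ
  have hca : orient c m a = -(τ * orient a b c) := by
    rw [orient_rotate, orient_lineMap, orient_self_mid, orient_rotate b a c, orient_swap]
    ring
  have hcb : orient c m b = (1 - τ) * orient a b c := by
    rw [orient_rotate, orient_lineMap, orient_self_mid, orient_rotate]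
    ring
  have hcm : c ≠ m := by
    rintro hcm
    rw [← hcm, orient_rotate, orient_self_right] at hca hcb
    exact h (by linarith)
  have hperm (p q r : Plane) : ({p, q, r} : Set Plane) = {r, q, p} := by
    rw [Set.insert_comm, Set.pair_comm, Set.insert_comm]
  refine measure_mono_null (fun x ⟨hxa, hxb⟩ => ?_) (volume_setOf_orient_eq_zero hcm)
  rw [hperm] at hxa
  rw [Set.insert_comm, hperm] at hxb
  obtain ⟨u, hu, hxu⟩ := exists_orient_eq_mul_of_mem_convexHull hxa
  obtain ⟨v, hv, hxv⟩ := exists_orient_eq_mul_of_mem_convexHull hxb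
  rw [hca] at hxu
  rw [hcb] at hxv
  have hzero : u * τ + v * (1 - τ) = 0 := mul_right_cancel₀ h (by linear_combination hxu - hxv)
  have huτ : u * τ = 0 := by nlinarith [mul_nonneg hu hτ0, mul_nonneg hv (sub_nonneg.2 hτ1)]
  rw [Set.mem_ofPred_eq, hxu, mul_neg, ← mul_assoc, huτ, zero_mul, neg_zero]

theorem setIntegral_triangle_eq_add {a b m : Plane} (hm : m ∈ segment ℝ a b) (c : Plane)
    {f : Plane → ℝ} (hf : Continuous f) :
    ∫ x in convexHull ℝ ({a, b, c} : Set Plane), f x =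
      (∫ x in convexHull ℝ ({a, m, c} : Set Plane), f x) +
        ∫ x in convexHull ℝ ({m, b, c} : Set Plane), f x := by
  have hcompact (p q r : Plane) : IsCompact (convexHull ℝ ({p, q, r} : Set Plane)) :=
    (Set.toFinite _).isCompact_convexHull ℝ
  rw [convexHull_triple_eq_union hm]
  exact setIntegral_union₀ (aedisjoint_convexHull_triple hm c)
    (hcompact m b c).measurableSet.nullMeasurableSet
    (hf.continuousOn.integrableOn_compact (hcompact a m c))
    (hf.continuousOn.integrableOn_compact (hcompact m b c))

theorem setIntegral_triangle_eq_add_add {a b c o : Plane}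
    (ho : o ∈ convexHull ℝ ({a, b, c} : Set Plane)) {f : Plane → ℝ} (hf : Continuous f) :
    ∫ x in convexHull ℝ ({a, b, c} : Set Plane), f x =
      (∫ x in convexHull ℝ ({a, b, o} : Set Plane), f x) +
        (∫ x in convexHull ℝ ({b, c, o} : Set Plane), f x) +
        ∫ x in convexHull ℝ ({c, a, o} : Set Plane), f x := by
  rw [← convexJoin_segment_singleton, convexJoin_singleton_right, Set.mem_iUnion₂] at ho
  obtain ⟨d, hd, hod⟩ := ho
  have hrot (p q r : Plane) : ({p, q, r} : Set Plane) = {q, r, p} := by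
    rw [Set.insert_comm, Set.pair_comm]
  have hleft := setIntegral_triangle_eq_add hod a hf
  have hright := setIntegral_triangle_eq_add (segment_symm ℝ d c ▸ hod) b hf
  rw [← hrot a d c, ← hrot a d o, hrot o c a] at hleft
  rw [hrot c d b, ← hrot b c o, hrot o d b] at hright
  rw [setIntegral_triangle_eq_add hd c hf, setIntegral_triangle_eq_add hd o hf, hleft, hright]
  ring

section Voronoi

variable {E : Type*} [NormedAddCommGroup E] [InnerProductSpace ℝ E]

theorem convex_setOf_dist_le_dist (a b : E) : Convex ℝ {x | dist x a ≤ dist x b} := by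
  have hset : {x | dist x a ≤ dist x b} =
      {x | inner ℝ (b - a) x ≤ (‖b‖ ^ 2 - ‖a‖ ^ 2) / 2} := by
    ext x
    rw [Set.mem_ofPred_eq, Set.mem_ofPred_eq, ← sq_le_sq₀ dist_nonneg dist_nonneg, dist_eq_norm,
      dist_eq_norm, norm_sub_sq_real, norm_sub_sq_real, inner_sub_left, real_inner_comm x,
      real_inner_comm x]
    constructor <;> intro h <;> linarith
  rw [hset]
  exact convex_halfSpace_le (innerSL ℝ (b - a)).isBoundedLinearMap.toIsLinearMap _

theorem dist_midpoint_le_dist {a b c : E} (hc : 0 ≤ inner ℝ (a - c) (b - c)) :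
    dist (midpoint ℝ a b) a ≤ dist (midpoint ℝ a b) c := by
  have hmedian := dist_sq_add_dist_sq_eq_two_mul_dist_midpoint_sq_add_half_dist_sq c a b
  have hcos : dist a b ^ 2 = dist c a ^ 2 - 2 * inner ℝ (a - c) (b - c) + dist c b ^ 2 := by
    rw [dist_comm c, dist_comm c, dist_eq_norm, dist_eq_norm, dist_eq_norm, ← norm_sub_sq_real,
      sub_sub_sub_cancel_right]
  rw [dist_midpoint_left, ← sq_le_sq₀ (by positivity) dist_nonneg, dist_comm _ c]
  norm_num
  linarith

theorem infDist_eq_dist_of_mem_convexHull_midpoint {a b c o x : E} {r : ℝ} (ha : dist a o = r)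
    (hb : dist b o = r) (hc : dist c o = r) (hacute : 0 ≤ inner ℝ (a - c) (b - c))
    (hx : x ∈ convexHull ℝ ({a, midpoint ℝ a b, o} : Set E)) :
    Metric.infDist x {a, b, c} = dist x a := by
  have hle {q : E} (hq : dist q o = r)
      (hmid : dist (midpoint ℝ a b) a ≤ dist (midpoint ℝ a b) q) : dist x a ≤ dist x q := by
    refine convexHull_min ?_ (convex_setOf_dist_le_dist a q) hx
    rintro y (rfl | rfl | rfl)
    · simp
    · exact hmid
    · rw [Set.mem_ofPred_eq, dist_comm, ha, dist_comm, hq]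
  refine le_antisymm (Metric.infDist_le_dist_of_mem (Set.mem_insert a _)) ?_
  rw [Metric.le_infDist (Set.insert_nonempty a _)]
  rintro y (rfl | rfl | rfl)
  · exact le_rfl
  · exact hle hb (by rw [dist_midpoint_left, dist_midpoint_right])
  · exact hle hc (dist_midpoint_le_dist hacute)

end Voronoi

theorem setIntegral_infDist_half {a b c o : Plane} {r : ℝ} (ha : dist a o = r)
    (hb : dist b o = r) (hc : dist c o = r) (hacute : 0 ≤ inner ℝ (a - c) (b - c))
    (h : orient a b o ≠ 0) :
    ∫ x in convexHull ℝ ({a, midpoint ℝ a b, o} : Set Plane),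
      Metric.infDist x ({a, b, c} : Set Plane) ^ 2 =
      |orient a b o| / 24 * (dist a b ^ 2 / 2 + r ^ 2) := by
  have hhalf : orient a (midpoint ℝ a b) o = orient a b o / 2 := by
    rw [← orient_rotate, ← orient_rotate, midpoint, orient_lineMap, orient_self_right,
      orient_rotate, orient_rotate, invOf_eq_inv]
    ring
  have hinner : inner ℝ (midpoint ℝ a b - a) (o - a) = dist a b ^ 2 / 4 := by
    rw [midpoint_sub_left, real_inner_smul_left,
      real_inner_eq_norm_mul_self_add_norm_mul_self_sub_norm_sub_mul_self_div_two,
      sub_sub_sub_cancel_right, ← dist_eq_norm, ← dist_eq_norm, ← dist_eq_norm, dist_comm o, ha,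
      hb, dist_comm b, invOf_eq_inv]
    ring
  rw [setIntegral_congr_fun ((Set.toFinite _).isCompact_convexHull ℝ).measurableSet
    (g := fun x => dist x a ^ 2)
    (fun x hx => by rw [infDist_eq_dist_of_mem_convexHull_midpoint ha hb hc hacute hx]),
    setIntegral_triangle_dist_sq (by rw [hhalf]; exact div_ne_zero h two_ne_zero), hhalf, hinner,
    dist_comm o, ha, dist_midpoint_left, abs_div, abs_two, Real.norm_ofNat]
  ring

theorem setIntegral_infDist_isosceles {a b c o : Plane} {r : ℝ} (ha : dist a o = r)
    (hb : dist b o = r) (hc : dist c o = r) (hacute : 0 ≤ inner ℝ (a - c) (b - c))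
    (h : orient a b o ≠ 0) :
    ∫ x in convexHull ℝ ({a, b, o} : Set Plane), Metric.infDist x ({a, b, c} : Set Plane) ^ 2 =
      |orient a b o| / 12 * (dist a b ^ 2 / 2 + r ^ 2) := by
  have hleft := setIntegral_infDist_half ha hb hc hacute h
  have hright := setIntegral_infDist_half hb ha hc (by rwa [real_inner_comm])
    (by rwa [orient_swap, neg_ne_zero])
  rw [midpoint_comm, Set.insert_comm b, Set.insert_comm b, orient_swap, abs_neg,
    dist_comm] at hright
  have hcont : Continuous fun x => Metric.infDist x ({a, b, c} : Set Plane) ^ 2 :=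
    (Metric.continuous_infDist_pt _).pow 2
  rw [setIntegral_triangle_eq_add (midpoint_mem_segment a b) o hcont, hleft, hright]
  ring

theorem two_mul_orient_mul_orient_of_dist_eq {a b c o : Plane} {r : ℝ} (ha : dist a o = r)
    (hb : dist b o = r) (hc : dist c o = r) :
    2 * orient b c o * orient a b c = dist b c ^ 2 * inner ℝ (b - a) (c - a) := by
  have hab := dist_sq_plane a o
  have hbb := dist_sq_plane b o
  have hcc := dist_sq_plane c o
  rw [ha] at hab
  rw [hb, hab] at hbb
  rw [hc, hab] at hcc
  simp only [dist_sq_plane, EuclideanSpace.inner_eq_star_dotProduct, dotProduct, Fin.sum_univ_two,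
    orient, PiLp.sub_apply, Pi.star_apply, star_trivial]
  linear_combination
    ((c 0 - a 0) * (b 0 - a 0) + (c 1 - a 1) * (b 1 - a 1) -
        ((b 0 - a 0) ^ 2 + (b 1 - a 1) ^ 2)) * hcc +
      ((c 0 - a 0) * (b 0 - a 0) + (c 1 - a 1) * (b 1 - a 1) -
        ((c 0 - a 0) ^ 2 + (c 1 - a 1) ^ 2)) * hbb

theorem orient_circumcenter_pos {a b c o : Plane} {r : ℝ} (ha : dist a o = r)
    (hb : dist b o = r) (hc : dist c o = r) (h : 0 < orient a b c)
    (hA : 0 < inner ℝ (b - a) (c - a)) : 0 < orient b c o := by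
  have hbc : b ≠ c := (ne_of_orient_ne_zero h.ne').2.2
  have hprod : 0 < 2 * orient b c o * orient a b c :=
    two_mul_orient_mul_orient_of_dist_eq ha hb hc ▸ mul_pos (pow_pos (dist_pos.2 hbc) 2) hA
  linarith [pos_of_mul_pos_left hprod h.le]

theorem orient_mul_dist_sq_add {a b c o : Plane} {r : ℝ} (ha : dist a o = r)
    (hb : dist b o = r) (hc : dist c o = r) :
    orient c a o * dist a b ^ 2 + orient a b o * dist c a ^ 2 = 2 * orient a b c * r ^ 2 := by
  have hab := dist_sq_plane a o
  have hbb := dist_sq_plane b o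
  have hcc := dist_sq_plane c o
  rw [ha] at hab
  rw [hb] at hbb
  rw [hc] at hcc
  simp only [dist_sq_plane]
  linear_combination (norm := (unfold orient; ring1))
    -(orient c a o + orient a b o + 2 * orient b c o) * hab - orient c a o * hbb -
      orient a b o * hcc

theorem setIntegral_infDist_acute {a b c o : Plane} {r : ℝ} (h : 0 < orient a b c)
    (ha : dist a o = r) (hb : dist b o = r) (hc : dist c o = r)
    (hA : 0 < inner ℝ (b - a) (c - a)) (hB : 0 < inner ℝ (c - b) (a - b))
    (hC : 0 < inner ℝ (a - c) (b - c)) :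
    ∫ x in convexHull ℝ ({a, b, c} : Set Plane), Metric.infDist x ({a, b, c} : Set Plane) ^ 2 =
      orient a b c / 24 * (dist a b ^ 2 + dist b c ^ 2 + dist c a ^ 2 - 4 * r ^ 2) := by
  have hbc : 0 < orient b c o := orient_circumcenter_pos ha hb hc h hA
  have hca : 0 < orient c a o := orient_circumcenter_pos hb hc ha (by rwa [orient_rotate]) hB
  have hab : 0 < orient a b o := orient_circumcenter_pos hc ha hb (by rwa [← orient_rotate]) hC
  have ho : o ∈ convexHull ℝ ({a, b, c} : Set Plane) := by
    rw [mem_convexHull_triple_iff_orient h, ← orient_rotate o b c, orient_rotate c a o]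
    exact ⟨hbc.le, hca.le, hab.le⟩
  have hcont : Continuous fun x => Metric.infDist x ({a, b, c} : Set Plane) ^ 2 :=
    (Metric.continuous_infDist_pt _).pow 2
  have hIab := setIntegral_infDist_isosceles ha hb hc hC.le hab.ne'
  have hIbc := setIntegral_infDist_isosceles hb hc ha hA.le hbc.ne'
  have hIca := setIntegral_infDist_isosceles hc ha hb hB.le hca.ne'
  have hrot (p q s : Plane) : ({p, q, s} : Set Plane) = {q, s, p} := by
    rw [Set.insert_comm, Set.pair_comm]
  rw [← hrot a b c] at hIbc
  rw [hrot c a b] at hIca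
  rw [setIntegral_triangle_eq_add_add ho hcont, hIab, hIbc, hIca, abs_of_pos hab, abs_of_pos hbc,
    abs_of_pos hca]
  have hsum := orient_add a b c o
  have hAB := orient_mul_dist_sq_add ha hb hc
  have hBC := orient_mul_dist_sq_add hb hc ha
  have hCA := orient_mul_dist_sq_add hc ha hb
  rw [← orient_rotate o b c, orient_rotate c a o] at hsum
  rw [orient_rotate a b c] at hBC
  rw [← orient_rotate c a b] at hCA
  linear_combination (dist a b ^ 2 + dist b c ^ 2 + dist c a ^ 2 + 2 * r ^ 2) / 24 * hsum -
    (hAB + hBC + hCA) / 24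

theorem inner_sub_sub_pos_of_angle_lt {V P : Type*} [NormedAddCommGroup V]
    [InnerProductSpace ℝ V] [MetricSpace P] [NormedAddTorsor V P] {a b c : P}
    (h : ∠ a b c < Real.pi / 2) : 0 < inner ℝ (a -ᵥ b) (c -ᵥ b) := by
  rw [EuclideanGeometry.angle, InnerProductGeometry.angle, Real.arccos_lt_pi_div_two] at h
  by_contra! hle
  exact h.not_ge (div_nonpos_of_nonpos_of_nonneg hle (by positivity))

namespace IsTriangle

variable {t : Finset Plane}

theorem setIntegral_infDist_of_isAcute (ht : IsTriangle t) (hacute : IsAcute t) :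
    ∫ x in convexHull ℝ (t : Set Plane), Metric.infDist x (t : Set Plane) ^ 2 =
      triangleArea t / 12 * (sumSqEdges t - 4 * triangleCircumradius t ^ 2) := by
  obtain ⟨o, ho⟩ := ht.exists_circumcircle
  obtain ⟨a, b, c, rfl, h⟩ := ht.exists_orient_pos
  obtain ⟨hab, hac, hbc⟩ := ne_of_orient_ne_zero h.ne'
  have hA := inner_sub_sub_pos_of_angle_lt
    (hacute b (by simp) a (by simp) c (by simp) hab.symm hac hbc.symm)
  have hB := inner_sub_sub_pos_of_angle_lt
    (hacute c (by simp) b (by simp) a (by simp) hbc.symm hab.symm hac)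
  have hC := inner_sub_sub_pos_of_angle_lt
    (hacute a (by simp) c (by simp) b (by simp) hac hbc.symm hab.symm)
  rw [triangleArea_triple h.ne', sumSqEdges_triple hab hac hbc, abs_of_pos h, Finset.coe_insert,
    Finset.coe_insert, Finset.coe_singleton, setIntegral_infDist_acute h (ho a (by simp))
    (ho b (by simp)) (ho c (by simp)) hA hB hC]
  ring

theorem voronoiTriangle_eq (ht : IsTriangle t) :
    voronoiTriangle t =
      triangleArea t / 12 * (sumSqEdges t - 4 * triangleCircumradius t ^ 2) := by
  unfold voronoiTriangle
  split_ifs with hacute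
  · exact ht.setIntegral_infDist_of_isAcute hacute
  · rfl

theorem radiusWeight_two (ht : IsTriangle t) :
    radiusWeight 2 t = 3 * rajanTriangle t - 3 * voronoiTriangle t := by
  rw [ht.voronoiTriangle_eq, radiusWeight, rajanTriangle, Real.rpow_two]
  ring

end IsTriangle

theorem mainTheorem7 (S : Finset Plane) :
    -- a Delaunay triangulation exists, and its triangles are unique in general position
    (∃ D : GeometricTriangulation S, D.IsDelaunay) ∧
    (NoFourCocircular S → ∀ D : GeometricTriangulation S, D.IsDelaunay →
      D.triangles = delaunayTriangles S) ∧
    -- it minimizes `R_2` and `R_1` among all geometric triangulations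
    (∀ D : GeometricTriangulation S, D.IsDelaunay → ∀ K : GeometricTriangulation S,
      D.radiusFunctional 2 ≤ K.radiusFunctional 2 ∧
      D.radiusFunctional 1 ≤ K.radiusFunctional 1) ∧
    -- the identities for `R_2` and `R_1`
    (∀ K : GeometricTriangulation S,
      K.radiusFunctional 2 = 3 * K.rajan - 3 * K.voronoi ∧
      K.radiusFunctional 1 = 1 / 4 * ∑ t ∈ K.triangles, prodEdges t) := by
  refine ⟨exists_delaunay S, fun hS D hD => D.isTriangulation.eq_delaunayTriangles hS hD,
    fun D hD K => ⟨?_, ?_⟩, fun K => ⟨?_, ?_⟩⟩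
  · exact K.isTriangulation.sum_radiusWeight_le_of_delaunay D.isTriangulation hD
      fun h => h.radiusWeight_two_lt
  · exact K.isTriangulation.sum_radiusWeight_le_of_delaunay D.isTriangulation hD
      fun h => h.radiusWeight_one_lt
  · rw [GeometricTriangulation.rajan, GeometricTriangulation.voronoi, Finset.mul_sum,
      Finset.mul_sum, ← Finset.sum_sub_distrib]
    exact Finset.sum_congr rfl fun t ht => (K.isTriangulation.isTriangle t ht).radiusWeight_two
  · rw [Finset.mul_sum]
    exact Finset.sum_congr rfl fun t ht => (K.isTriangulation.isTriangle t ht).radiusWeight_one
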